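/- Let $K$ be a set. Call two subsets of a set orthogonal if they intersect in exactly one point, and for a set $S$ of subsets of $X$ let $S^\perp$ be the set of all subsets of $X$ orthogonal to every member of $S$. An object of the category $\mathbf{G}(\mathsf{Rel}^K)$ is a set $X$ of leaves, each labelled by an element of $K$, with two sets of subsets of $X$, the coresolutions and the resolutions. A morphism is a binary relation between leaves that relates only leaves with the same label and satisfies the resolution condition: inverse images of resolutions are resolutions and direct images of coresolutions are coresolutions. Composition is composition of relations. An abstract proposition $(X,S)$ is a $K$-labelled set $X$ with a set $S$ of subsets of $X$ such that $S^{\perp\perp}=S$; it is identified with the object of $\mathbf{G}(\mathsf{Rel}^K)$ with leaves $X$, coresolutions $S^\perp$ and resolutions $S$. It is syntactic if, up to renaming leaves, $X$ is the labelled set of leaves of a formula $\varphi$ built from elements of $K$ by binary $\wedge$ and $\vee$ (without constants), and $S$ is the set of maximal stable sets of the graph on $X$ that joins two leaves iff they meet at a $\wedge$ in the parse tree of $\varphi$. Let $\mathsf{CW}_K$ be the full subcategory of $\mathbf{G}(\mathsf{Rel}^K)$ on the syntactic propositions. Theorem. $\mathsf{CW}_K$ is the free binary product-sum category generated by the set $K$,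 in the following two senses. (1) $\mathsf{CW}_K$ has binary products and binary coproducts, and for every category $\mathcal{C}$ with binary products and binary coproducts, restriction along the map sending $k\in K$ to the one-leaf proposition labelled $k$ (whose only resolution is the whole leaf set) is an equivalence of categories from the category of functors $\mathsf{CW}_K\to\mathcal{C}$ preserving binary products and binary coproducts (with all natural transformations) to the category $\mathcal{C}^K$ of $K$-indexed families of objects of $\mathcal{C}$. (2) For abstract propositions $(X,S)$ and $(Y,T)$ put $(X,S)\vee(Y,T)=(X+Y,\{s+t: s\in S,\ t\in T\})$ and $(X,S)\wedge(Y,T)=(X+Y,\{s'+t': s'\in S^\perp,\ t'\in T^\perp\}^\perp)$, where $X+Y$ is the disjoint union with the inherited labels. Let $\mathsf{CW}'_K$ be the category whose objects are the formulas built from elements of $K$ by $\wedge$ and $\vee$, and whose morphisms are the $\mathbf{G}(\mathsf{Rel}^K)$-morphisms between the propositions generated from the one-leaf propositions by these two operations according to the formulas. Then, in $\mathsf{CW}'_K$, the operations $\wedge$ and $\vee$, with the relations matching each leaf with its copy as projections and injections, are binary products and binary coproducts. Moreover $\mathsf{CW}'_K$ is initial: for every category $\mathcal{C}$ with chosen binary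 products and coproducts and every map $f$ from $K$ to the objects of $\mathcal{C}$, there is a unique functor $F:\mathsf{CW}'_K\to\mathcal{C}$ that strictly preserves the chosen products and coproducts, including projections and injections, and satisfies $F(k)=f(k)$ for all $k\in K$. -/

import Mathlib

open CategoryTheory CategoryTheory.Limits

universe u u₁ v₁ u₂ v₂

namespace CWLogic

/-! ### Set systems and orthogonality -/

/-- Two subsets are orthogonal when they intersect in a single point. -/
def Orthogonal {X : Type u} (s t : Set X) : Prop := ∃! x, x ∈ s ∩ t

/-- The orthogonal of a set of subsets of `X`. -/
def orth {X : Type u} (S : Set (Set X)) : Set (Set X) :=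
  {t | ∀ s ∈ S, Orthogonal t s}

theorem Orthogonal.symm {X : Type u} {s t : Set X} (h : Orthogonal s t) : Orthogonal t s := by
  unfold Orthogonal at *
  rwa [Set.inter_comm]

theorem subset_orth_orth {X : Type u} (S : Set (Set X)) : S ⊆ orth (orth S) :=
  fun _ hs _ ht => (ht _ hs).symm

theorem orth_anti {X : Type u} {S T : Set (Set X)} (h : S ⊆ T) : orth T ⊆ orth S :=
  fun _ ht s hs => ht s (h hs)

theorem orth_orth_orth {X : Type u} (S : Set (Set X)) : orth (orth (orth S)) = orth S :=
  (orth_anti (subset_orth_orth S)).antisymm (subset_orth_orth _)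

/-- All unions `s + t` (inside the disjoint union `X + Y`) with `s ∈ S` and `t ∈ T`. -/
def sumSets {X Y : Type u} (S : Set (Set X)) (T : Set (Set Y)) : Set (Set (X ⊕ Y)) :=
  {w | ∃ s ∈ S, ∃ t ∈ T, w = Sum.inl '' s ∪ Sum.inr '' t}

theorem sumSets_iff {X Y : Type u} (S : Set (Set X)) (T : Set (Set Y)) (w : Set (X ⊕ Y)) :
    w ∈ sumSets S T ↔ Sum.inl ⁻¹' w ∈ S ∧ Sum.inr ⁻¹' w ∈ T := by
  constructor
  · rintro ⟨s, hs, t, ht, rfl⟩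
    have h1 : Sum.inl ⁻¹' (Sum.inl '' s ∪ Sum.inr '' t : Set (X ⊕ Y)) = s := by ext; simp
    have h2 : Sum.inr ⁻¹' (Sum.inl '' s ∪ Sum.inr '' t : Set (X ⊕ Y)) = t := by ext; simp
    rw [h1, h2]
    exact ⟨hs, ht⟩
  · rintro ⟨hs, ht⟩
    refine ⟨_, hs, _, ht, ?_⟩
    ext (x | x) <;> simp

theorem inl_mem_orth_sumSets {X Y : Type u} {S : Set (Set X)} (T : Set (Set Y)) {u : Set X}
    (hu : u ∈ orth S) : (Sum.inl '' u : Set (X ⊕ Y)) ∈ orth (sumSets S T) := by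
  rintro w hw
  obtain ⟨x, ⟨h1, h2⟩, h3⟩ := hu _ ((sumSets_iff S T w).1 hw).1
  refine ⟨Sum.inl x, ⟨⟨x, h1, rfl⟩, h2⟩, ?_⟩
  rintro _ ⟨⟨y, hy, rfl⟩, hy'⟩
  rw [h3 y ⟨hy, hy'⟩]

theorem inr_mem_orth_sumSets {X Y : Type u} (S : Set (Set X)) {T : Set (Set Y)} {u : Set Y}
    (hu : u ∈ orth T) : (Sum.inr '' u : Set (X ⊕ Y)) ∈ orth (sumSets S T) := by
  rintro w hw
  obtain ⟨x, ⟨h1, h2⟩, h3⟩ := hu _ ((sumSets_iff S T w).1 hw).2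
  refine ⟨Sum.inr x, ⟨⟨x, h1, rfl⟩, h2⟩, ?_⟩
  rintro _ ⟨⟨y, hy, rfl⟩, hy'⟩
  rw [h3 y ⟨hy, hy'⟩]

theorem orthogonal_inl_image {X Y : Type u} {w : Set (X ⊕ Y)} {s : Set X}
    (h : Orthogonal w (Sum.inl '' s)) : Orthogonal (Sum.inl ⁻¹' w) s := by
  obtain ⟨_, ⟨h1, ⟨x, hx, rfl⟩⟩, h3⟩ := h
  exact ⟨x, ⟨h1, hx⟩, fun y hy => Sum.inl_injective (h3 _ ⟨hy.1, y, hy.2, rfl⟩)⟩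

theorem orthogonal_inr_image {X Y : Type u} {w : Set (X ⊕ Y)} {s : Set Y}
    (h : Orthogonal w (Sum.inr '' s)) : Orthogonal (Sum.inr ⁻¹' w) s := by
  obtain ⟨_, ⟨h1, ⟨x, hx, rfl⟩⟩, h3⟩ := h
  exact ⟨x, ⟨h1, hx⟩, fun y hy => Sum.inr_injective (h3 _ ⟨hy.1, y, hy.2, rfl⟩)⟩

theorem orth_orth_sumSets {X Y : Type u} {S : Set (Set X)} {T : Set (Set Y)}
    (hS : orth (orth S) = S) (hT : orth (orth T) = T) :
    orth (orth (sumSets S T)) = sumSets S T := by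
  refine Set.Subset.antisymm (fun w hw => ?_) (subset_orth_orth _)
  rw [sumSets_iff]
  constructor
  · rw [← hS]
    exact fun u hu => orthogonal_inl_image (hw _ (inl_mem_orth_sumSets T hu))
  · rw [← hT]
    exact fun u hu => orthogonal_inr_image (hw _ (inr_mem_orth_sumSets S hu))

/-- Each element of `X` is related to its copy in the disjoint union `X + Y`. -/
def sumInlRel (X Y : Type u) : SetRel X (X ⊕ Y) := {p | Sum.inl p.1 = p.2}

/-- Each element of `Y` is related to its copy in the disjoint union `X + Y`. -/
def sumInrRel (X Y : Type u) : SetRel Y (X ⊕ Y) := {p | Sum.inr p.1 = p.2}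

/-- The copy in the disjoint union `X + Y` of an element of `X` is related to that element. -/
def prodFstRel (X Y : Type u) : SetRel (X ⊕ Y) X := {p | p.1 = Sum.inl p.2}

/-- The copy in the disjoint union `X + Y` of an element of `Y` is related to that element. -/
def prodSndRel (X Y : Type u) : SetRel (X ⊕ Y) Y := {p | p.1 = Sum.inr p.2}

theorem preimage_sumInlRel {X Y : Type u} {S : Set (Set X)} {T : Set (Set Y)}
    {t : Set (X ⊕ Y)} (ht : t ∈ sumSets S T) : (sumInlRel X Y).preimage t ∈ S := by
  have h : (sumInlRel X Y).preimage t = Sum.inl ⁻¹' t := by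
    ext; simp [SetRel.preimage, sumInlRel]
  rw [h]
  exact ((sumSets_iff _ _ t).1 ht).1

theorem image_sumInlRel {X Y : Type u} (T : Set (Set Y)) {S : Set (Set X)}
    {s : Set X} (hs : s ∈ orth S) : (sumInlRel X Y).image s ∈ orth (sumSets S T) := by
  have h : (sumInlRel X Y).image s = Sum.inl '' s := by
    ext; simp [SetRel.image, sumInlRel]
  rw [h]
  exact inl_mem_orth_sumSets _ hs

theorem preimage_prodFstRel {X Y : Type u} (T : Set (Set Y)) {S : Set (Set X)}
    (hS : orth (orth S) = S) {t : Set X} (ht : t ∈ S) :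
    (prodFstRel X Y).preimage t ∈ orth (sumSets (orth S) (orth T)) := by
  have h : (prodFstRel X Y).preimage t = Sum.inl '' t := by
    ext; simp [SetRel.preimage, prodFstRel, eq_comm]
  rw [h]
  exact inl_mem_orth_sumSets _ (hS.symm.subset ht)

theorem image_prodFstRel {X Y : Type u} {S : Set (Set X)} {T : Set (Set Y)}
    {s : Set (X ⊕ Y)} (hs : s ∈ sumSets S T) : (prodFstRel X Y).image s ∈ S := by
  have h : (prodFstRel X Y).image s = Sum.inl ⁻¹' s := by
    ext; simp [SetRel.image, prodFstRel]
  rw [h]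
  exact ((sumSets_iff _ _ s).1 hs).1

theorem preimage_sumInrRel {X Y : Type u} {S : Set (Set X)} {T : Set (Set Y)}
    {t : Set (X ⊕ Y)} (ht : t ∈ sumSets S T) : (sumInrRel X Y).preimage t ∈ T := by
  have h : (sumInrRel X Y).preimage t = Sum.inr ⁻¹' t := by
    ext; simp [SetRel.preimage, sumInrRel]
  rw [h]
  exact ((sumSets_iff _ _ t).1 ht).2

theorem image_sumInrRel {X Y : Type u} (S : Set (Set X)) {T : Set (Set Y)}
    {s : Set Y} (hs : s ∈ orth T) : (sumInrRel X Y).image s ∈ orth (sumSets S T) := by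
  have h : (sumInrRel X Y).image s = Sum.inr '' s := by
    ext; simp [SetRel.image, sumInrRel]
  rw [h]
  exact inr_mem_orth_sumSets _ hs

theorem preimage_prodSndRel {X Y : Type u} (S : Set (Set X)) {T : Set (Set Y)}
    (hT : orth (orth T) = T) {t : Set Y} (ht : t ∈ T) :
    (prodSndRel X Y).preimage t ∈ orth (sumSets (orth S) (orth T)) := by
  have h : (prodSndRel X Y).preimage t = Sum.inr '' t := by
    ext; simp [SetRel.preimage, prodSndRel, eq_comm]
  rw [h]
  exact inr_mem_orth_sumSets _ (hT.symm.subset ht)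

theorem image_prodSndRel {X Y : Type u} {S : Set (Set X)} {T : Set (Set Y)}
    {s : Set (X ⊕ Y)} (hs : s ∈ sumSets S T) : (prodSndRel X Y).image s ∈ T := by
  have h : (prodSndRel X Y).image s = Sum.inr ⁻¹' s := by
    ext; simp [SetRel.image, prodSndRel]
  rw [h]
  exact ((sumSets_iff _ _ s).1 hs).2

/-! ### The double-glued category `G(Rel^K)` -/

/-- An object of `G(Rel^K)`: an object of `Rel^K`, that is, a set of leaves each of which is
labelled by an element of `K`, with two (independent) sets of subsets. -/
structure GRel (K : Type u) : Type (u + 1) where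
  /-- The leaves. -/
  Leaf : Type u
  /-- The labelling of the leaves. -/
  label : Leaf → K
  /-- The coresolutions (the covariant part). -/
  cores : Set (Set Leaf)
  /-- The resolutions (the contravariant part). -/
  res : Set (Set Leaf)

namespace GRel

variable {K : Type u}

/-- A morphism of `G(Rel^K)`: a relation between leaves that respects labels and satisfies the
resolution condition. -/
@[ext]
structure Hom (A B : GRel K) : Type u where
  /-- The underlying relation. -/
  rel : SetRel A.Leaf B.Leaf
  label_eq : ∀ x y, (x, y) ∈ rel → A.label x = B.label y
  /-- The relation pulls resolutions backwards. -/
  preimage_res : ∀ t ∈ B.res, rel.preimage t ∈ A.res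
  /-- The relation pushes coresolutions forwards. -/
  image_cores : ∀ s ∈ A.cores, rel.image s ∈ B.cores

/-- Identities are identity relations, composition is composition of relations. -/
instance : Category.{u} (GRel K) where
  Hom A B := Hom A B
  id A :=
    { rel := SetRel.id
      label_eq := by rintro x y rfl; rfl
      preimage_res := fun t ht => by rwa [SetRel.preimage_id]
      image_cores := fun s hs => by rwa [SetRel.image_id] }
  comp {A B C} R R' :=
    { rel := R.rel.comp R'.rel
      label_eq := by
        rintro x z ⟨y, hxy, hyz⟩
        exact (R.label_eq x y hxy).trans (R'.label_eq y z hyz)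
      preimage_res := fun t ht => by
        rw [SetRel.preimage_comp]
        exact R.preimage_res _ (R'.preimage_res t ht)
      image_cores := fun s hs => by
        rw [SetRel.image_comp]
        exact R'.image_cores _ (R.image_cores s hs) }
  id_comp R := Hom.ext (SetRel.id_comp R.rel)
  comp_id R := Hom.ext (SetRel.comp_id R.rel)
  assoc R R' R'' := Hom.ext (SetRel.comp_assoc R.rel R'.rel R''.rel)

end GRel

/-! ### Abstract propositions -/

/-- An abstract proposition over `K`: a set of leaves labelled in `K`, and a set `S` of subsets,
called resolutions, that is equal to its double orthogonal. -/
structure AbsProp (K : Type u) : Type (u + 1) where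
  /-- The leaves. -/
  Leaf : Type u
  /-- The labelling of the leaves. -/
  label : Leaf → K
  /-- The resolutions. -/
  res : Set (Set Leaf)
  orth_orth_res : orth (orth res) = res

namespace AbsProp

variable {K : Type u}

/-- The object `(X, S⊥, S)` of `G(Rel^K)` given by an abstract proposition `(X, S)`. -/
abbrev toGRel (A : AbsProp K) : GRel K where
  Leaf := A.Leaf
  label := A.label
  cores := orth A.res
  res := A.res

/-- A single vertex with label `k`; its only resolution is the whole leaf set. -/
def vertex (k : K) : AbsProp K where
  Leaf := PUnit
  label _ := k
  res := {Set.univ}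
  orth_orth_res := by
    refine Set.Subset.antisymm (fun s hs => ?_) (subset_orth_orth _)
    have h : (Set.univ : Set PUnit.{u + 1}) ∈ orth {Set.univ} := by
      rintro _ rfl
      exact ⟨⟨⟩, by simp, fun _ _ => rfl⟩
    obtain ⟨x, ⟨hx, -⟩, -⟩ := hs _ h
    ext y
    simpa using hx

/-- Sum: disjoint union on leaves, and a resolution of `A ∨ B` is the union of a resolution
of `A` and a resolution of `B`. -/
abbrev disj (A B : AbsProp K) : AbsProp K where
  Leaf := A.Leaf ⊕ B.Leaf
  label := Sum.elim A.label B.label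
  res := sumSets A.res B.res
  orth_orth_res := orth_orth_sumSets A.orth_orth_res B.orth_orth_res

/-- The orthogonal `(X, S⊥)` of `(X, S)`, with the labels unchanged. (The relabelling in a
negation plays no role in `A ∧ B = ¬(¬A ∨ ¬B)`, where it is performed twice.) -/
abbrev perp (A : AbsProp K) : AbsProp K where
  Leaf := A.Leaf
  label := A.label
  res := orth A.res
  orth_orth_res := orth_orth_orth A.res

/-- Product, the de Morgan dual of the sum. -/
abbrev conj (A B : AbsProp K) : AbsProp K := (A.perp.disj B.perp).perp

/-- The first projection `A ∧ B → A` relates each leaf of `A` to itself. -/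
def fst (A B : AbsProp K) : (A.conj B).toGRel ⟶ A.toGRel where
  rel := prodFstRel A.Leaf B.Leaf
  label_eq x y h := by obtain rfl : x = Sum.inl y := h; rfl
  preimage_res _ ht := preimage_prodFstRel _ A.orth_orth_res ht
  image_cores _ hs := image_prodFstRel ((A.perp.disj B.perp).orth_orth_res.subset hs)

/-- The second projection `A ∧ B → B` relates each leaf of `B` to itself. -/
def snd (A B : AbsProp K) : (A.conj B).toGRel ⟶ B.toGRel where
  rel := prodSndRel A.Leaf B.Leaf
  label_eq x y h := by obtain rfl : x = Sum.inr y := h; rfl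
  preimage_res _ ht := preimage_prodSndRel _ B.orth_orth_res ht
  image_cores _ hs := image_prodSndRel ((A.perp.disj B.perp).orth_orth_res.subset hs)

/-- The first injection `A → A ∨ B` relates each leaf of `A` to itself. -/
def inl (A B : AbsProp K) : A.toGRel ⟶ (A.disj B).toGRel where
  rel := sumInlRel A.Leaf B.Leaf
  label_eq x y h := by obtain rfl : Sum.inl x = y := h; rfl
  preimage_res _ ht := preimage_sumInlRel ht
  image_cores _ hs := image_sumInlRel _ hs

/-- The second injection `B → A ∨ B` relates each leaf of `B` to itself. -/
def inr (A B : AbsProp K) : B.toGRel ⟶ (A.disj B).toGRel where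
  rel := sumInrRel A.Leaf B.Leaf
  label_eq x y h := by obtain rfl : Sum.inr x = y := h; rfl
  preimage_res _ ht := preimage_sumInrRel ht
  image_cores _ hs := image_sumInrRel _ hs

end AbsProp

/-! ### Formulas, their graphs, and syntactic propositions -/

/-- Formulas built from elements of `K` by `∧` and `∨` (without units). -/
inductive Formula (K : Type u) : Type u
  | atom : K → Formula K
  | and : Formula K → Formula K → Formula K
  | or : Formula K → Formula K → Formula K

namespace Formula

variable {K : Type u}

/-- The leaves of the parse tree of a formula. -/
def Leaf : Formula K → Type u
  | atom _ => PUnit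
  | and φ ψ => φ.Leaf ⊕ ψ.Leaf
  | or φ ψ => φ.Leaf ⊕ ψ.Leaf

/-- The label of a leaf. -/
def label : (φ : Formula K) → φ.Leaf → K
  | atom k, _ => k
  | and φ ψ, x => Sum.elim φ.label ψ.label x
  | or φ ψ, x => Sum.elim φ.label ψ.label x

/-- Two leaves meet at a `∧` in the parse tree. -/
def MeetAtAnd : (φ : Formula K) → φ.Leaf → φ.Leaf → Prop
  | atom _, _, _ => False
  | and φ _, .inl x, .inl y => φ.MeetAtAnd x y
  | and _ ψ, .inr x, .inr y => ψ.MeetAtAnd x y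
  | and _ _, .inl _, .inr _ => True
  | and _ _, .inr _, .inl _ => True
  | or φ _, .inl x, .inl y => φ.MeetAtAnd x y
  | or _ ψ, .inr x, .inr y => ψ.MeetAtAnd x y
  | or _ _, .inl _, .inr _ => False
  | or _ _, .inr _, .inl _ => False

theorem MeetAtAnd.symm : ∀ (φ : Formula K) (x y : φ.Leaf), φ.MeetAtAnd x y → φ.MeetAtAnd y x
  | atom _, _, _, h => h
  | and φ _, .inl x, .inl y, h => MeetAtAnd.symm φ x y h
  | and _ ψ, .inr x, .inr y, h => MeetAtAnd.symm ψ x y h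
  | and _ _, .inl _, .inr _, h => h
  | and _ _, .inr _, .inl _, h => h
  | or φ _, .inl x, .inl y, h => MeetAtAnd.symm φ x y h
  | or _ ψ, .inr x, .inr y, h => MeetAtAnd.symm ψ x y h
  | or _ _, .inl _, .inr _, h => h
  | or _ _, .inr _, .inl _, h => h

theorem MeetAtAnd.irrefl : ∀ (φ : Formula K) (x : φ.Leaf), ¬ φ.MeetAtAnd x x
  | atom _, _, h => h
  | and φ _, .inl x, h => MeetAtAnd.irrefl φ x h
  | and _ ψ, .inr x, h => MeetAtAnd.irrefl ψ x h
  | or φ _, .inl x, h => MeetAtAnd.irrefl φ x h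
  | or _ ψ, .inr x, h => MeetAtAnd.irrefl ψ x h

/-- The graph of a formula: an edge joins two leaves iff they meet at a `∧`. -/
def graph (φ : Formula K) : SimpleGraph φ.Leaf where
  Adj := φ.MeetAtAnd
  symm := ⟨fun x y => MeetAtAnd.symm φ x y⟩
  loopless := ⟨MeetAtAnd.irrefl φ⟩

/-- The abstract proposition generated from vertices by `∧` and `∨` along a formula. -/
def toAbsProp : Formula K → AbsProp K
  | atom k => AbsProp.vertex k
  | and φ ψ => φ.toAbsProp.conj ψ.toAbsProp
  | or φ ψ => φ.toAbsProp.disj ψ.toAbsProp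

end Formula

/-- An abstract proposition is syntactic if it is obtained from some formula `φ`: up to the names
of the leaves, its labelled leaves are those of `φ` and its resolutions are the maximal stable
sets of the graph of `φ`. -/
def AbsProp.IsSyntactic {K : Type u} (A : AbsProp K) : Prop :=
  ∃ (φ : Formula K) (e : A.Leaf ≃ φ.Leaf), (∀ x, φ.label (e x) = A.label x) ∧
    ∀ s : Set A.Leaf, s ∈ A.res ↔ Maximal (fun t => φ.graph.IsIndepSet t) (e '' s)

theorem AbsProp.vertex_isSyntactic {K : Type u} (k : K) : (AbsProp.vertex k).IsSyntactic := by
  refine ⟨Formula.atom k, Equiv.refl PUnit, fun _ => rfl, fun s => ?_⟩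
  have hind : ∀ t : Set (Formula.atom k).Leaf, (Formula.atom k).graph.IsIndepSet t :=
    fun t x _ y _ _ h => h
  have key : s ∈ (AbsProp.vertex k).res ↔ s = Set.univ := Iff.rfl
  rw [key]
  constructor
  · rintro rfl
    exact ⟨hind _, fun t _ _ x _ => ⟨x, trivial, rfl⟩⟩
  · intro h
    ext x
    refine ⟨fun _ => trivial, fun _ => ?_⟩
    obtain ⟨y, hy, -⟩ := h.2 (hind Set.univ) (fun _ _ => trivial) (Set.mem_univ x)
    exact hy

/-! ### The category `CW_K` -/

/-- The objects of `G(Rel^K)` that are syntactic propositions. -/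
def syntacticProperty (K : Type u) : ObjectProperty (GRel K) :=
  fun X => ∃ A : AbsProp K, A.IsSyntactic ∧ A.toGRel = X

/-- `CW_K`: the full subcategory of `G(Rel^K)` on the syntactic propositions. -/
abbrev CW (K : Type u) : Type (u + 1) := (syntacticProperty K).FullSubcategory

/-- The inclusion of generators: `k` is sent to the single vertex with label `k`. -/
def CW.gen {K : Type u} (k : K) : CW K :=
  ⟨(AbsProp.vertex k).toGRel, AbsProp.vertex k, AbsProp.vertex_isSyntactic k, rfl⟩

/-- Functors that preserve binary products and binary sums. -/
def productSumFunctor (C : Type u₁) [Category.{v₁} C] (D : Type u₂) [Category.{v₂} D] :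
    ObjectProperty (C ⥤ D) :=
  fun F => PreservesLimitsOfShape (Discrete WalkingPair) F ∧
    PreservesColimitsOfShape (Discrete WalkingPair) F

/-- For `gen : K → P` and a category `C`, restriction along `gen` of the functors `P ⥤ C` that
preserve binary products and sums, as a functor to the category of `K`-indexed families of
objects of `C`. The morphisms on the left are all natural transformations. -/
def restrictToGenerators {K : Type u} {P : Type u₁} [Category.{v₁} P] (gen : K → P)
    (C : Type u₂) [Category.{v₂} C] :
    (productSumFunctor P C).FullSubcategory ⥤ (Discrete K ⥤ C) :=
  (productSumFunctor P C).ι ⋙ (Functor.whiskeringLeft _ _ C).obj (Discrete.functor gen)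

/-! ### Chosen products and sums, and the strict version of `CW_K` -/

/-- A choice, for each pair of objects, of a span and a cospan on it. -/
structure ProductSumData (C : Type u₁) [Category.{v₁} C] where
  prod : C → C → C
  fst : ∀ X Y, prod X Y ⟶ X
  snd : ∀ X Y, prod X Y ⟶ Y
  sum : C → C → C
  inl : ∀ X Y, X ⟶ sum X Y
  inr : ∀ X Y, Y ⟶ sum X Y

/-- The chosen spans are binary products and the chosen cospans are binary sums, so that the
category is a binary product-sum category with chosen products and sums. -/
structure ProductSumData.IsProductSum {C : Type u₁} [Category.{v₁} C]
    (S : ProductSumData C) : Prop where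
  isProduct : ∀ X Y, Nonempty (IsLimit (BinaryFan.mk (S.fst X Y) (S.snd X Y)))
  isSum : ∀ X Y, Nonempty (IsColimit (BinaryCofan.mk (S.inl X Y) (S.inr X Y)))

/-- The functor `F` preserves the chosen products and sums on the nose, including projections and
injections. -/
structure StrictlyPreserves {C : Type u₁} [Category.{v₁} C] {D : Type u₂} [Category.{v₂} D]
    (S : ProductSumData C) (T : ProductSumData D) (F : C ⥤ D) : Prop where
  obj_prod : ∀ X Y, F.obj (S.prod X Y) = T.prod (F.obj X) (F.obj Y)
  map_fst : ∀ X Y, F.map (S.fst X Y) = eqToHom (obj_prod X Y) ≫ T.fst (F.obj X) (F.obj Y)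
  map_snd : ∀ X Y, F.map (S.snd X Y) = eqToHom (obj_prod X Y) ≫ T.snd (F.obj X) (F.obj Y)
  obj_sum : ∀ X Y, F.obj (S.sum X Y) = T.sum (F.obj X) (F.obj Y)
  map_inl : ∀ X Y, F.map (S.inl X Y) = T.inl (F.obj X) (F.obj Y) ≫ eqToHom (obj_sum X Y).symm
  map_inr : ∀ X Y, F.map (S.inr X Y) = T.inr (F.obj X) (F.obj Y) ≫ eqToHom (obj_sum X Y).symm

/-- The strict version of `CW_K`: the objects are the propositions generated from the vertices
`k ∈ K` by `∧` and `∨`, in bijection with formulas; the morphisms are those of `G(Rel^K)`. -/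
abbrev CWStrict (K : Type u) : Type u :=
  InducedCategory (GRel K) (fun φ : Formula K => φ.toAbsProp.toGRel)

/-- The object of the strict version of `CW_K` given by a generator. -/
def CWStrict.gen {K : Type u} (k : K) : CWStrict K := Formula.atom k

/-- The operations `∧` and `∨` with their projections and injections. -/
def CWStrict.data (K : Type u) : ProductSumData (CWStrict K) where
  prod φ ψ := Formula.and φ ψ
  fst φ ψ := InducedCategory.homMk (AbsProp.fst (Formula.toAbsProp φ) (Formula.toAbsProp ψ))
  snd φ ψ := InducedCategory.homMk (AbsProp.snd (Formula.toAbsProp φ) (Formula.toAbsProp ψ))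
  sum φ ψ := Formula.or φ ψ
  inl φ ψ := InducedCategory.homMk (AbsProp.inl (Formula.toAbsProp φ) (Formula.toAbsProp ψ))
  inr φ ψ := InducedCategory.homMk (AbsProp.inr (Formula.toAbsProp φ) (Formula.toAbsProp ψ))

end CWLogic

open CWLogic

/-!
The category of formulas `CWStrict K` is shown to be the free category with chosen binary products
and sums on `K`, and the statement about `CW K` is deduced from an equivalence between the two.

In a proposition generated by a formula every leaf lies in a resolution and in a coresolution
(`AbsProp.IsCovered`). Consequently a resolution of `A ∧ B` is a resolution of `A` or one of `B`,
and a coresolution of `A ∨ B` is a coresolution of `A` or one of `B`. This makes `∧` and `∨`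
products and sums, and it also makes the category *soft* in the sense of Joyal: a morphism
`A ∧ B → C ∨ D` factors through a projection or an injection (`AbsProp.conj_disj_factor`), and if
`fst ≫ f = g ≫ inl` then both sides come from a single morphism `A → C`
(`AbsProp.fst_comp_eq_comp_inl` and its variants). Softness yields an induction principle
(`CWStrict.hom_induction`): all morphisms arise from identities of generators by pairing,
copairing, precomposition with projections and postcomposition with injections.

Existence of the functor into a category `C` with chosen products and sums comes from the relation
`IsInterp` between morphisms of formulas and morphisms of `C`, generated by these cut-free rules.
It is total by the induction principle and single-valued by the inversion lemmas
`IsInterp.comp_fst` and `IsInterp.exists_of_comp_inl` and their variants (`IsInterp.unique`), and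
it is closed under composition by cut elimination (`IsInterp.comp`).

Both uniqueness statements come from one lemma (`PreservesFormulas.naturality`): a family of
morphisms between two functors on formulas that is natural with respect to projections and
injections is natural. Applied to the identifications `eqToHom` it shows that strict functors
agreeing on generators are equal; applied to a family extended from generators by recursion on
formulas it shows that restriction to generators is full.

Finally the resolutions of the proposition generated by a formula are the maximal stable sets of
its graph (`Formula.mem_res_iff_maximal`), so that `CWStrict K → CW K` is an equivalence, along
which products, sums and functors are transported.
-/

namespace CWLogic

variable {K : Type u}

/-! ### Resolutions and coresolutions of sums and products -/

/-- The orthogonality relations of `A` reach every leaf: each leaf lies in a resolution and in a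
coresolution. Every proposition generated by a formula has this property, and it is what makes
the resolutions of `A ∧ B` be exactly those of `A` and those of `B`. -/
structure AbsProp.IsCovered (A : AbsProp K) : Prop where
  nonempty : Nonempty A.Leaf
  exists_res : ∀ x : A.Leaf, ∃ s ∈ A.res, x ∈ s
  exists_cores : ∀ x : A.Leaf, ∃ s ∈ orth A.res, x ∈ s

theorem orthogonal_inl_image_iff {X Y : Type u} {w : Set (X ⊕ Y)} {s : Set X} :
    Orthogonal (Sum.inl '' s) w ↔ Orthogonal s (Sum.inl ⁻¹' w) := by
  constructor
  · exact fun h => (orthogonal_inl_image h.symm).symm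
  · rintro ⟨x, ⟨hx, hx'⟩, h⟩
    refine ⟨Sum.inl x, ⟨⟨x, hx, rfl⟩, hx'⟩, ?_⟩
    rintro _ ⟨⟨y, hy, rfl⟩, hy'⟩
    rw [h y ⟨hy, hy'⟩]

theorem orthogonal_inr_image_iff {X Y : Type u} {w : Set (X ⊕ Y)} {s : Set Y} :
    Orthogonal (Sum.inr '' s) w ↔ Orthogonal s (Sum.inr ⁻¹' w) := by
  constructor
  · exact fun h => (orthogonal_inr_image h.symm).symm
  · rintro ⟨x, ⟨hx, hx'⟩, h⟩
    refine ⟨Sum.inr x, ⟨⟨x, hx, rfl⟩, hx'⟩, ?_⟩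
    rintro _ ⟨⟨y, hy, rfl⟩, hy'⟩
    rw [h y ⟨hy, hy'⟩]

/-- A set orthogonal to all sums `s + t` lies on one side of the disjoint union: two elements on
different sides would both lie in a suitable `s + t`. -/
theorem mem_orth_sumSets {X Y : Type u} {S : Set (Set X)} {T : Set (Set Y)}
    (hX : Nonempty X) (hY : Nonempty Y)
    (hS : ∀ x, ∃ s ∈ S, x ∈ s) (hT : ∀ y, ∃ t ∈ T, y ∈ t) (w : Set (X ⊕ Y)) :
    w ∈ orth (sumSets S T) ↔
      (∃ s ∈ orth S, w = Sum.inl '' s) ∨ (∃ t ∈ orth T, w = Sum.inr '' t) := by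
  constructor
  · intro hw
    have sides : ∀ x y, Sum.inl x ∈ w → Sum.inr y ∈ w → False := by
      intro x y hx hy
      obtain ⟨s, hs, hxs⟩ := hS x
      obtain ⟨t, ht, hyt⟩ := hT y
      obtain ⟨z, -, hz⟩ := hw _ ⟨s, hs, t, ht, rfl⟩
      have h1 := hz _ ⟨hx, Or.inl ⟨x, hxs, rfl⟩⟩
      have h2 := hz _ ⟨hy, Or.inr ⟨y, hyt, rfl⟩⟩
      exact Sum.inl_ne_inr (h1.trans h2.symm)
    by_cases hne : ∃ y, Sum.inr y ∈ w
    · obtain ⟨y, hy⟩ := hne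
      have hw' : w = Sum.inr '' (Sum.inr ⁻¹' w) := by
        ext (x | y')
        · simpa using fun hx => sides x y hx hy
        · simp
      refine Or.inr ⟨_, fun t ht => ?_, hw'⟩
      obtain ⟨x⟩ := hX
      obtain ⟨s, hs, -⟩ := hS x
      have key := hw _ ⟨s, hs, t, ht, rfl⟩
      rw [hw', orthogonal_inr_image_iff] at key
      simpa [Set.preimage_union, Set.preimage_image_eq _ Sum.inr_injective] using key
    · have hw' : w = Sum.inl '' (Sum.inl ⁻¹' w) := by
        ext (x | y')
        · simp
        · simpa using fun hy => hne ⟨y', hy⟩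
      refine Or.inl ⟨_, fun s hs => ?_, hw'⟩
      obtain ⟨y⟩ := hY
      obtain ⟨t, ht, -⟩ := hT y
      have key := hw _ ⟨s, hs, t, ht, rfl⟩
      rw [hw', orthogonal_inl_image_iff] at key
      simpa [Set.preimage_union, Set.preimage_image_eq _ Sum.inl_injective] using key
  · rintro (⟨s, hs, rfl⟩ | ⟨t, ht, rfl⟩)
    · exact inl_mem_orth_sumSets _ hs
    · exact inr_mem_orth_sumSets _ ht

namespace AbsProp

theorem IsCovered.perp {A : AbsProp K} (hA : A.IsCovered) : A.perp.IsCovered where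
  nonempty := hA.nonempty
  exists_res := hA.exists_cores
  exists_cores x := by
    obtain ⟨s, hs, hx⟩ := hA.exists_res x
    exact ⟨s, subset_orth_orth _ hs, hx⟩

theorem IsCovered.disj {A B : AbsProp K} (hA : A.IsCovered) (hB : B.IsCovered) :
    (A.disj B).IsCovered where
  nonempty := hA.nonempty.map Sum.inl
  exists_res := by
    obtain ⟨a₀⟩ := hA.nonempty
    obtain ⟨b₀⟩ := hB.nonempty
    rintro (a | b)
    · obtain ⟨s, hs, ha⟩ := hA.exists_res a
      obtain ⟨t, ht, -⟩ := hB.exists_res b₀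
      exact ⟨_, ⟨s, hs, t, ht, rfl⟩, Or.inl ⟨a, ha, rfl⟩⟩
    · obtain ⟨s, hs, -⟩ := hA.exists_res a₀
      obtain ⟨t, ht, hb⟩ := hB.exists_res b
      exact ⟨_, ⟨s, hs, t, ht, rfl⟩, Or.inr ⟨b, hb, rfl⟩⟩
  exists_cores := by
    rintro (a | b)
    · obtain ⟨s, hs, ha⟩ := hA.exists_cores a
      exact ⟨_, inl_mem_orth_sumSets _ hs, ⟨a, ha, rfl⟩⟩
    · obtain ⟨s, hs, hb⟩ := hB.exists_cores b
      exact ⟨_, inr_mem_orth_sumSets _ hs, ⟨b, hb, rfl⟩⟩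

theorem IsCovered.conj {A B : AbsProp K} (hA : A.IsCovered) (hB : B.IsCovered) :
    (A.conj B).IsCovered :=
  (hA.perp.disj hB.perp).perp

theorem vertex_isCovered (k : K) : (vertex k).IsCovered where
  nonempty := ⟨PUnit.unit⟩
  exists_res _ := ⟨Set.univ, rfl, trivial⟩
  exists_cores _ := ⟨Set.univ, by
    rintro _ rfl
    exact ⟨⟨⟩, ⟨trivial, trivial⟩, fun _ _ => rfl⟩, trivial⟩

theorem mem_cores_disj {A B : AbsProp K} (hA : A.IsCovered) (hB : B.IsCovered)
    (w : Set (A.Leaf ⊕ B.Leaf)) : w ∈ orth (sumSets A.res B.res) ↔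
      (∃ s ∈ orth A.res, w = Sum.inl '' s) ∨ (∃ t ∈ orth B.res, w = Sum.inr '' t) :=
  mem_orth_sumSets hA.nonempty hB.nonempty hA.exists_res hB.exists_res w

theorem mem_res_conj {A B : AbsProp K} (hA : A.IsCovered) (hB : B.IsCovered)
    (w : Set (A.Leaf ⊕ B.Leaf)) : w ∈ orth (sumSets (orth A.res) (orth B.res)) ↔
      (∃ s ∈ A.res, w = Sum.inl '' s) ∨ (∃ t ∈ B.res, w = Sum.inr '' t) := by
  rw [mem_orth_sumSets hA.nonempty hB.nonempty hA.exists_cores hB.exists_cores w,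
    A.orth_orth_res, B.orth_orth_res]

theorem mem_cores_conj {A B : AbsProp K} (w : Set (A.Leaf ⊕ B.Leaf)) :
    w ∈ orth (orth (sumSets (orth A.res) (orth B.res))) ↔
      Sum.inl ⁻¹' w ∈ orth A.res ∧ Sum.inr ⁻¹' w ∈ orth B.res := by
  rw [(A.perp.disj B.perp).orth_orth_res, sumSets_iff]

end AbsProp

/-! ### Composites with projections and injections -/

theorem GRel.hom_ext {X Y : GRel K} {f g : X ⟶ Y}
    (h : ∀ x y, (x, y) ∈ GRel.Hom.rel f ↔ (x, y) ∈ GRel.Hom.rel g) : f = g :=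
  GRel.Hom.ext (Set.ext fun p => h p.1 p.2)

namespace AbsProp

section Composites

variable {A B : AbsProp K} {Z : GRel K}

theorem mem_comp_fst (f : Z ⟶ (A.conj B).toGRel) (z : Z.Leaf) (a : A.Leaf) :
    (z, a) ∈ GRel.Hom.rel (f ≫ fst A B) ↔ (z, Sum.inl a) ∈ GRel.Hom.rel f := by
  constructor
  · rintro ⟨_, h, rfl : _ = Sum.inl a⟩
    exact h
  · exact fun h => ⟨_, h, rfl⟩

theorem mem_comp_snd (f : Z ⟶ (A.conj B).toGRel) (z : Z.Leaf) (b : B.Leaf) :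
    (z, b) ∈ GRel.Hom.rel (f ≫ snd A B) ↔ (z, Sum.inr b) ∈ GRel.Hom.rel f := by
  constructor
  · rintro ⟨_, h, rfl : _ = Sum.inr b⟩
    exact h
  · exact fun h => ⟨_, h, rfl⟩

theorem mem_inl_comp (f : (A.disj B).toGRel ⟶ Z) (a : A.Leaf) (z : Z.Leaf) :
    (a, z) ∈ GRel.Hom.rel (inl A B ≫ f) ↔ (Sum.inl a, z) ∈ GRel.Hom.rel f := by
  constructor
  · rintro ⟨_, rfl : Sum.inl a = _, h⟩
    exact h
  · exact fun h => ⟨Sum.inl a, rfl, h⟩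

theorem mem_inr_comp (f : (A.disj B).toGRel ⟶ Z) (b : B.Leaf) (z : Z.Leaf) :
    (b, z) ∈ GRel.Hom.rel (inr A B ≫ f) ↔ (Sum.inr b, z) ∈ GRel.Hom.rel f := by
  constructor
  · rintro ⟨_, rfl : Sum.inr b = _, h⟩
    exact h
  · exact fun h => ⟨Sum.inr b, rfl, h⟩

theorem mem_fst_comp (f : A.toGRel ⟶ Z) (x : A.Leaf ⊕ B.Leaf) (z : Z.Leaf) :
    (x, z) ∈ GRel.Hom.rel (fst A B ≫ f) ↔ ∃ a, x = Sum.inl a ∧ (a, z) ∈ GRel.Hom.rel f :=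
  Iff.rfl

theorem mem_snd_comp (f : B.toGRel ⟶ Z) (x : A.Leaf ⊕ B.Leaf) (z : Z.Leaf) :
    (x, z) ∈ GRel.Hom.rel (snd A B ≫ f) ↔ ∃ b, x = Sum.inr b ∧ (b, z) ∈ GRel.Hom.rel f :=
  Iff.rfl

theorem mem_comp_inl (f : Z ⟶ A.toGRel) (z : Z.Leaf) (x : A.Leaf ⊕ B.Leaf) :
    (z, x) ∈ GRel.Hom.rel (f ≫ inl A B) ↔ ∃ a, (z, a) ∈ GRel.Hom.rel f ∧ Sum.inl a = x :=
  Iff.rfl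

theorem mem_comp_inr (f : Z ⟶ B.toGRel) (z : Z.Leaf) (x : A.Leaf ⊕ B.Leaf) :
    (z, x) ∈ GRel.Hom.rel (f ≫ inr A B) ↔ ∃ b, (z, b) ∈ GRel.Hom.rel f ∧ Sum.inr b = x :=
  Iff.rfl

theorem conj_hom_ext {f g : Z ⟶ (A.conj B).toGRel} (h₁ : f ≫ fst A B = g ≫ fst A B)
    (h₂ : f ≫ snd A B = g ≫ snd A B) : f = g := by
  refine GRel.hom_ext ?_
  rintro z (a | b)
  · rw [← mem_comp_fst, h₁, mem_comp_fst]
  · rw [← mem_comp_snd, h₂, mem_comp_snd]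

theorem disj_hom_ext {f g : (A.disj B).toGRel ⟶ Z} (h₁ : inl A B ≫ f = inl A B ≫ g)
    (h₂ : inr A B ≫ f = inr A B ≫ g) : f = g := by
  refine GRel.hom_ext ?_
  rintro (a | b) z
  · rw [← mem_inl_comp, h₁, mem_inl_comp]
  · rw [← mem_inr_comp, h₂, mem_inr_comp]

/-- The pairing of two morphisms, as the union of the two relations. -/
theorem exists_conj_lift (hA : A.IsCovered) (hB : B.IsCovered) (f : Z ⟶ A.toGRel)
    (g : Z ⟶ B.toGRel) : ∃ h : Z ⟶ (A.conj B).toGRel, h ≫ fst A B = f ∧ h ≫ snd A B = g := by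
  let h : Z ⟶ (A.conj B).toGRel :=
    { rel := {p | Sum.elim (fun a => (p.1, a) ∈ GRel.Hom.rel f)
        (fun b => (p.1, b) ∈ GRel.Hom.rel g) p.2}
      label_eq := by
        rintro z (a | b) h
        · exact f.label_eq z a h
        · exact g.label_eq z b h
      preimage_res := by
        intro w hw
        obtain ⟨s, hs, rfl⟩ | ⟨t, ht, rfl⟩ := (mem_res_conj hA hB w).1 hw
        · convert f.preimage_res s hs using 1
          ext z
          simp
        · convert g.preimage_res t ht using 1
          ext z
          simp
      image_cores := by
        intro s hs
        refine (mem_cores_conj (A := A) (B := B) _).2 ⟨?_, ?_⟩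
        · exact f.image_cores s hs
        · exact g.image_cores s hs }
  exact ⟨h, GRel.hom_ext fun z a => mem_comp_fst h z a, GRel.hom_ext fun z b => mem_comp_snd h z b⟩

/-- The copairing of two morphisms, as the union of the two relations. -/
theorem exists_disj_desc (hA : A.IsCovered) (hB : B.IsCovered) (f : A.toGRel ⟶ Z)
    (g : B.toGRel ⟶ Z) : ∃ h : (A.disj B).toGRel ⟶ Z, inl A B ≫ h = f ∧ inr A B ≫ h = g := by
  let h : (A.disj B).toGRel ⟶ Z :=
    { rel := {p | Sum.elim (fun a => (a, p.2) ∈ GRel.Hom.rel f)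
        (fun b => (b, p.2) ∈ GRel.Hom.rel g) p.1}
      label_eq := by
        rintro (a | b) z h
        · exact f.label_eq a z h
        · exact g.label_eq b z h
      preimage_res := by
        intro t ht
        refine (sumSets_iff _ _ _).2 ⟨?_, ?_⟩
        · exact f.preimage_res t ht
        · exact g.preimage_res t ht
      image_cores := by
        intro w hw
        obtain ⟨s, hs, rfl⟩ | ⟨t, ht, rfl⟩ := (mem_cores_disj hA hB w).1 hw
        · convert f.image_cores s hs using 1
          ext z
          simp
        · convert g.image_cores t ht using 1
          ext z
          simp }
  exact ⟨h, GRel.hom_ext fun a z => mem_inl_comp h a z, GRel.hom_ext fun b z => mem_inr_comp h b z⟩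

theorem fst_comp_cancel {f g : A.toGRel ⟶ Z} (h : fst A B ≫ f = fst A B ≫ g) : f = g := by
  refine GRel.hom_ext fun a z => ?_
  have := mem_fst_comp (B := B) f (Sum.inl a) z
  rw [h, mem_fst_comp] at this
  simpa using this.symm

theorem snd_comp_cancel {f g : B.toGRel ⟶ Z} (h : snd A B ≫ f = snd A B ≫ g) : f = g := by
  refine GRel.hom_ext fun a z => ?_
  have := mem_snd_comp (A := A) f (Sum.inr a) z
  rw [h, mem_snd_comp] at this
  simpa using this.symm

theorem comp_inl_cancel {f g : Z ⟶ A.toGRel} (h : f ≫ inl A B = g ≫ inl A B) : f = g := by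
  refine GRel.hom_ext fun z a => ?_
  have := mem_comp_inl (B := B) f z (Sum.inl a)
  rw [h, mem_comp_inl] at this
  simpa using this.symm

theorem comp_inr_cancel {f g : Z ⟶ B.toGRel} (h : f ≫ inr A B = g ≫ inr A B) : f = g := by
  refine GRel.hom_ext fun z a => ?_
  have := mem_comp_inr (A := A) f z (Sum.inr a)
  rw [h, mem_comp_inr] at this
  simpa using this.symm

/-! ### Softness: morphisms from products to sums factor -/

/-- A morphism into a sum whose relation only reaches the first summand factors through the first
injection: a resolution of the summand is completed by any fixed resolution of the other one. -/
theorem exists_eq_comp_inl (hB : B.IsCovered) (f : Z ⟶ (A.disj B).toGRel)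
    (hf : ∀ z b, (z, Sum.inr b) ∉ GRel.Hom.rel f) : ∃ g : Z ⟶ A.toGRel, f = g ≫ inl A B := by
  obtain ⟨b₀⟩ := hB.nonempty
  obtain ⟨t₀, ht₀, -⟩ := hB.exists_res b₀
  let g : Z ⟶ A.toGRel :=
    { rel := {p | (p.1, Sum.inl p.2) ∈ GRel.Hom.rel f}
      label_eq := fun z a h => f.label_eq z (Sum.inl a) h
      preimage_res := by
        intro s hs
        convert f.preimage_res _ ⟨s, hs, t₀, ht₀, rfl⟩ using 1
        ext z
        simp [hf]
      image_cores := by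
        intro s hs t ht
        have h := f.image_cores s hs _ ⟨t, ht, t₀, ht₀, rfl⟩
        have himg : (GRel.Hom.rel f).image s =
            Sum.inl '' (SetRel.image {p | (p.1, Sum.inl p.2) ∈ GRel.Hom.rel f} s) := by
          ext (a | b)
          · simp
          · simpa using fun z _ => hf z b
        rw [himg, orthogonal_inl_image_iff] at h
        simpa [Set.preimage_union, Set.preimage_image_eq _ Sum.inl_injective] using h }
  refine ⟨g, GRel.hom_ext ?_⟩
  rintro z (a | b)
  · refine ⟨fun h => (mem_comp_inl g z _).2 ⟨a, h, rfl⟩, fun h => ?_⟩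
    obtain ⟨_, h, h'⟩ := (mem_comp_inl g z _).1 h
    cases h'
    exact h
  · refine iff_of_false (hf _ _) fun h => ?_
    obtain ⟨_, -, h'⟩ := (mem_comp_inl g z _).1 h
    cases h'

theorem exists_eq_comp_inr (hA : A.IsCovered) (f : Z ⟶ (A.disj B).toGRel)
    (hf : ∀ z a, (z, Sum.inl a) ∉ GRel.Hom.rel f) : ∃ g : Z ⟶ B.toGRel, f = g ≫ inr A B := by
  obtain ⟨a₀⟩ := hA.nonempty
  obtain ⟨s₀, hs₀, -⟩ := hA.exists_res a₀
  let g : Z ⟶ B.toGRel :=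
    { rel := {p | (p.1, Sum.inr p.2) ∈ GRel.Hom.rel f}
      label_eq := fun z b h => f.label_eq z (Sum.inr b) h
      preimage_res := by
        intro t ht
        convert f.preimage_res _ ⟨s₀, hs₀, t, ht, rfl⟩ using 1
        ext z
        simp [hf]
      image_cores := by
        intro s hs t ht
        have h := f.image_cores s hs _ ⟨s₀, hs₀, t, ht, rfl⟩
        have himg : (GRel.Hom.rel f).image s =
            Sum.inr '' (SetRel.image {p | (p.1, Sum.inr p.2) ∈ GRel.Hom.rel f} s) := by
          ext (a | b)
          · simpa using fun z _ => hf z a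
          · simp
        rw [himg, orthogonal_inr_image_iff] at h
        simpa [Set.preimage_union, Set.preimage_image_eq _ Sum.inr_injective] using h }
  refine ⟨g, GRel.hom_ext ?_⟩
  rintro z (a | b)
  · refine iff_of_false (hf _ _) fun h => ?_
    obtain ⟨_, -, h'⟩ := (mem_comp_inr g z _).1 h
    cases h'
  · refine ⟨fun h => (mem_comp_inr g z _).2 ⟨b, h, rfl⟩, fun h => ?_⟩
    obtain ⟨_, h, h'⟩ := (mem_comp_inr g z _).1 h
    cases h'
    exact h

/-- A morphism out of a product whose relation is only defined on the first factor factors through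
the first projection: a coresolution of the factor is completed by any fixed one of the other. -/
theorem exists_eq_fst_comp (hB : B.IsCovered) (f : (A.conj B).toGRel ⟶ Z)
    (hf : ∀ b z, (Sum.inr b, z) ∉ GRel.Hom.rel f) : ∃ g : A.toGRel ⟶ Z, f = fst A B ≫ g := by
  obtain ⟨b₀⟩ := hB.nonempty
  obtain ⟨t₀, ht₀, -⟩ := hB.exists_cores b₀
  let g : A.toGRel ⟶ Z :=
    { rel := {p | (Sum.inl p.1, p.2) ∈ GRel.Hom.rel f}
      label_eq := fun a z h => f.label_eq (Sum.inl a) z h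
      preimage_res := by
        intro t ht
        refine A.orth_orth_res.subset fun s hs => ?_
        have h := f.preimage_res t ht _ ⟨s, hs, t₀, ht₀, rfl⟩
        have himg : (GRel.Hom.rel f).preimage t =
            Sum.inl '' (SetRel.preimage {p | (Sum.inl p.1, p.2) ∈ GRel.Hom.rel f} t) := by
          ext (a | b)
          · simp
          · simpa using fun z _ => hf b z
        rw [himg, orthogonal_inl_image_iff] at h
        simpa [Set.preimage_union, Set.preimage_image_eq _ Sum.inl_injective] using h
      image_cores := by
        intro s hs
        convert f.image_cores (Sum.inl '' s ∪ Sum.inr '' t₀)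
          (subset_orth_orth _ ⟨s, hs, t₀, ht₀, rfl⟩) using 1
        ext z
        simp [hf] }
  refine ⟨g, GRel.hom_ext ?_⟩
  rintro (a | b) z
  · refine ⟨fun h => (mem_fst_comp g _ z).2 ⟨a, rfl, h⟩, fun h => ?_⟩
    obtain ⟨_, h', h⟩ := (mem_fst_comp g _ z).1 h
    cases h'
    exact h
  · refine iff_of_false (hf _ _) fun h => ?_
    obtain ⟨_, h', -⟩ := (mem_fst_comp g _ z).1 h
    cases h'

theorem exists_eq_snd_comp (hA : A.IsCovered) (f : (A.conj B).toGRel ⟶ Z)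
    (hf : ∀ a z, (Sum.inl a, z) ∉ GRel.Hom.rel f) : ∃ g : B.toGRel ⟶ Z, f = snd A B ≫ g := by
  obtain ⟨a₀⟩ := hA.nonempty
  obtain ⟨s₀, hs₀, -⟩ := hA.exists_cores a₀
  let g : B.toGRel ⟶ Z :=
    { rel := {p | (Sum.inr p.1, p.2) ∈ GRel.Hom.rel f}
      label_eq := fun b z h => f.label_eq (Sum.inr b) z h
      preimage_res := by
        intro t ht
        refine B.orth_orth_res.subset fun s hs => ?_
        have h := f.preimage_res t ht _ ⟨s₀, hs₀, s, hs, rfl⟩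
        have himg : (GRel.Hom.rel f).preimage t =
            Sum.inr '' (SetRel.preimage {p | (Sum.inr p.1, p.2) ∈ GRel.Hom.rel f} t) := by
          ext (a | b)
          · simpa using fun z _ => hf a z
          · simp
        rw [himg, orthogonal_inr_image_iff] at h
        simpa [Set.preimage_union, Set.preimage_image_eq _ Sum.inr_injective] using h
      image_cores := by
        intro s hs
        convert f.image_cores (Sum.inl '' s₀ ∪ Sum.inr '' s)
          (subset_orth_orth _ ⟨s₀, hs₀, s, hs, rfl⟩) using 1
        ext z
        simp [hf] }
  refine ⟨g, GRel.hom_ext ?_⟩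
  rintro (a | b) z
  · refine iff_of_false (hf _ _) fun h => ?_
    obtain ⟨_, h', -⟩ := (mem_snd_comp g _ z).1 h
    cases h'
  · refine ⟨fun h => (mem_snd_comp g _ z).2 ⟨b, rfl, h⟩, fun h => ?_⟩
    obtain ⟨_, h', h⟩ := (mem_snd_comp g _ z).1 h
    cases h'
    exact h

end Composites

variable {A B C D : AbsProp K}

/-- Softness. If a relation `A ∧ B → C ∨ D` factors through no projection and no injection, it
contains two pairs with sources on different sides of `A + B` and targets on different sides of
`C + D`. A resolution of `C ∨ D` through both targets then has an inverse image meeting both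
`A` and `B`, which no resolution of `A ∧ B` does. -/
theorem conj_disj_factor (hA : A.IsCovered) (hB : B.IsCovered) (hC : C.IsCovered)
    (hD : D.IsCovered) (f : (A.conj B).toGRel ⟶ (C.disj D).toGRel) :
    (∃ g : A.toGRel ⟶ (C.disj D).toGRel, f = fst A B ≫ g) ∨
    (∃ g : B.toGRel ⟶ (C.disj D).toGRel, f = snd A B ≫ g) ∨
    (∃ g : (A.conj B).toGRel ⟶ C.toGRel, f = g ≫ inl C D) ∨
    (∃ g : (A.conj B).toGRel ⟶ D.toGRel, f = g ≫ inr C D) := by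
  -- neither diagonal of the block decomposition of `f` has two nonempty blocks
  have hno : ∀ a b c d, (Sum.inl a, Sum.inl c) ∈ GRel.Hom.rel f →
      (Sum.inr b, Sum.inr d) ∈ GRel.Hom.rel f → False := by
    intro a b c d h₁ h₂
    obtain ⟨s, hs, hcs⟩ := hC.exists_res c
    obtain ⟨t, ht, hdt⟩ := hD.exists_res d
    have hw := f.preimage_res _ ⟨s, hs, t, ht, rfl⟩
    have ha : Sum.inl a ∈ (GRel.Hom.rel f).preimage (Sum.inl '' s ∪ Sum.inr '' t) :=
      ⟨_, Or.inl ⟨c, hcs, rfl⟩, h₁⟩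
    have hb : Sum.inr b ∈ (GRel.Hom.rel f).preimage (Sum.inl '' s ∪ Sum.inr '' t) :=
      ⟨_, Or.inr ⟨d, hdt, rfl⟩, h₂⟩
    obtain ⟨_, -, h⟩ | ⟨_, -, h⟩ := (mem_res_conj hA hB _).1 hw
    · rw [h] at hb; simp at hb
    · rw [h] at ha; simp at ha
  have hno' : ∀ a b c d, (Sum.inl a, Sum.inr d) ∈ GRel.Hom.rel f →
      (Sum.inr b, Sum.inl c) ∈ GRel.Hom.rel f → False := by
    intro a b c d h₁ h₂
    obtain ⟨s, hs, hcs⟩ := hC.exists_res c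
    obtain ⟨t, ht, hdt⟩ := hD.exists_res d
    have hw := f.preimage_res _ ⟨s, hs, t, ht, rfl⟩
    have ha : Sum.inl a ∈ (GRel.Hom.rel f).preimage (Sum.inl '' s ∪ Sum.inr '' t) :=
      ⟨_, Or.inr ⟨d, hdt, rfl⟩, h₁⟩
    have hb : Sum.inr b ∈ (GRel.Hom.rel f).preimage (Sum.inl '' s ∪ Sum.inr '' t) :=
      ⟨_, Or.inl ⟨c, hcs, rfl⟩, h₂⟩
    obtain ⟨_, -, h⟩ | ⟨_, -, h⟩ := (mem_res_conj hA hB _).1 hw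
    · rw [h] at hb; simp at hb
    · rw [h] at ha; simp at ha
  by_contra! hcon
  obtain ⟨h₁, h₂, h₃, h₄⟩ := hcon
  have e₁ : ∃ b z, (Sum.inr b, z) ∈ GRel.Hom.rel f := by
    by_contra! h
    obtain ⟨g, hg⟩ := exists_eq_fst_comp hB f h
    exact h₁ g hg
  have e₂ : ∃ a z, (Sum.inl a, z) ∈ GRel.Hom.rel f := by
    by_contra! h
    obtain ⟨g, hg⟩ := exists_eq_snd_comp hA f h
    exact h₂ g hg
  have e₃ : ∃ z d, (z, Sum.inr d) ∈ GRel.Hom.rel f := by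
    by_contra! h
    obtain ⟨g, hg⟩ := exists_eq_comp_inl hD f h
    exact h₃ g hg
  have e₄ : ∃ z c, (z, Sum.inl c) ∈ GRel.Hom.rel f := by
    by_contra! h
    obtain ⟨g, hg⟩ := exists_eq_comp_inr hC f h
    exact h₄ g hg
  obtain ⟨b, c | d, hb⟩ := e₁ <;> obtain ⟨a, c' | d', ha⟩ := e₂
  · obtain ⟨a' | b', d'', h⟩ := e₃
    · exact hno' _ _ _ _ h hb
    · exact hno _ _ _ _ ha h
  · exact hno' _ _ _ _ ha hb
  · exact hno _ _ _ _ ha hb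
  · obtain ⟨a' | b', c'', h⟩ := e₄
    · exact hno _ _ _ _ h hb
    · exact hno' _ _ _ _ ha h

/-- The image of the leaf is a coresolution of `C ∨ D`, so it lies in `C` or in `D`. -/
theorem vertex_disj_factor (k : K) (hC : C.IsCovered) (hD : D.IsCovered)
    (f : (vertex k).toGRel ⟶ (C.disj D).toGRel) :
    (∃ g : (vertex k).toGRel ⟶ C.toGRel, f = g ≫ inl C D) ∨
    (∃ g : (vertex k).toGRel ⟶ D.toGRel, f = g ≫ inr C D) := by
  obtain ⟨s, hs, hu⟩ := (vertex_isCovered k).exists_cores PUnit.unit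
  obtain ⟨_, -, h⟩ | ⟨_, -, h⟩ := (mem_cores_disj hC hD _).1 (f.image_cores s hs)
  · refine Or.inl (exists_eq_comp_inl hD f fun z d hz => ?_)
    have : Sum.inr d ∈ (GRel.Hom.rel f).image s := ⟨z, hu, hz⟩
    rw [h] at this
    simp at this
  · refine Or.inr (exists_eq_comp_inr hC f fun z d hz => ?_)
    have : Sum.inl d ∈ (GRel.Hom.rel f).image s := ⟨z, hu, hz⟩
    rw [h] at this
    simp at this

/-- The inverse image of the leaf is a resolution of `A ∧ B`, so it lies in `A` or in `B`. -/
theorem conj_vertex_factor (k : K) (hA : A.IsCovered) (hB : B.IsCovered)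
    (f : (A.conj B).toGRel ⟶ (vertex k).toGRel) :
    (∃ g : A.toGRel ⟶ (vertex k).toGRel, f = fst A B ≫ g) ∨
    (∃ g : B.toGRel ⟶ (vertex k).toGRel, f = snd A B ≫ g) := by
  obtain ⟨s, hs, hu⟩ := (vertex_isCovered k).exists_res PUnit.unit
  obtain ⟨_, -, h⟩ | ⟨_, -, h⟩ := (mem_res_conj hA hB _).1 (f.preimage_res s hs)
  · refine Or.inl (exists_eq_fst_comp hB f fun d z hz => ?_)
    have : Sum.inr d ∈ (GRel.Hom.rel f).preimage s := ⟨z, hu, hz⟩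
    rw [h] at this
    simp at this
  · refine Or.inr (exists_eq_snd_comp hA f fun d z hz => ?_)
    have : Sum.inl d ∈ (GRel.Hom.rel f).preimage s := ⟨z, hu, hz⟩
    rw [h] at this
    simp at this

theorem vertex_hom_label_eq {k l : K} (f : (vertex k).toGRel ⟶ (vertex l).toGRel) : k = l := by
  obtain ⟨s, hs, -⟩ := (vertex_isCovered k).exists_cores PUnit.unit
  obtain ⟨y, ⟨⟨x, -, h⟩, -⟩, -⟩ := f.image_cores s hs _ rfl
  exact f.label_eq x y h

theorem vertex_hom_eq_id {k : K} (f : (vertex k).toGRel ⟶ (vertex k).toGRel) : f = 𝟙 _ := by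
  obtain ⟨s, hs, -⟩ := (vertex_isCovered k).exists_cores PUnit.unit
  obtain ⟨y, ⟨⟨x, -, h⟩, -⟩, -⟩ := f.image_cores s hs _ rfl
  exact GRel.hom_ext fun _ _ => iff_of_true h rfl

theorem exists_mem_rel (hA : A.IsCovered) (hB : B.IsCovered) (f : A.toGRel ⟶ B.toGRel) :
    ∃ a b, (a, b) ∈ GRel.Hom.rel f := by
  obtain ⟨a⟩ := hA.nonempty
  obtain ⟨b⟩ := hB.nonempty
  obtain ⟨s, hs, -⟩ := hA.exists_cores a
  obtain ⟨t, ht, -⟩ := hB.exists_res b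
  obtain ⟨y, ⟨⟨x, -, h⟩, -⟩, -⟩ := f.image_cores s hs _ ht
  exact ⟨x, y, h⟩

theorem comp_inl_ne_comp_inr (hA : A.IsCovered) (hC : C.IsCovered) (f : A.toGRel ⟶ C.toGRel)
    (g : A.toGRel ⟶ D.toGRel) : f ≫ inl C D ≠ g ≫ inr C D := by
  intro h
  obtain ⟨a, c, hac⟩ := exists_mem_rel hA hC f
  have := (mem_comp_inl (B := D) f a (Sum.inl c)).2 ⟨c, hac, rfl⟩
  rw [h, mem_comp_inr] at this
  simp at this

theorem fst_comp_ne_snd_comp (hA : A.IsCovered) (hC : C.IsCovered) (f : A.toGRel ⟶ C.toGRel)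
    (g : B.toGRel ⟶ C.toGRel) : fst A B ≫ f ≠ snd A B ≫ g := by
  intro h
  obtain ⟨a, c, hac⟩ := exists_mem_rel hA hC f
  have := (mem_fst_comp (B := B) f (Sum.inl a) c).2 ⟨a, rfl, hac⟩
  rw [h, mem_snd_comp] at this
  simp at this

/-- A morphism that factors both through a projection and through an injection comes from a single
morphism between the components. With `conj_disj_factor` this is the uniqueness half of softness. -/
theorem fst_comp_eq_comp_inl (hD : D.IsCovered) {f : A.toGRel ⟶ (C.disj D).toGRel}
    {g : (A.conj B).toGRel ⟶ C.toGRel} (h : fst A B ≫ f = g ≫ inl C D) :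
    ∃ k : A.toGRel ⟶ C.toGRel, f = k ≫ inl C D ∧ g = fst A B ≫ k := by
  obtain ⟨k, rfl⟩ := exists_eq_comp_inl hD f fun a d had => by
    have := (mem_fst_comp (B := B) f (Sum.inl a) _).2 ⟨a, rfl, had⟩
    rw [h, mem_comp_inl] at this
    simp at this
  exact ⟨k, rfl, comp_inl_cancel (B := D) (by rw [← h, Category.assoc])⟩

theorem fst_comp_eq_comp_inr (hC : C.IsCovered) {f : A.toGRel ⟶ (C.disj D).toGRel}
    {g : (A.conj B).toGRel ⟶ D.toGRel} (h : fst A B ≫ f = g ≫ inr C D) :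
    ∃ k : A.toGRel ⟶ D.toGRel, f = k ≫ inr C D ∧ g = fst A B ≫ k := by
  obtain ⟨k, rfl⟩ := exists_eq_comp_inr hC f fun a d had => by
    have := (mem_fst_comp (B := B) f (Sum.inl a) _).2 ⟨a, rfl, had⟩
    rw [h, mem_comp_inr] at this
    simp at this
  exact ⟨k, rfl, comp_inr_cancel (A := C) (by rw [← h, Category.assoc])⟩

theorem snd_comp_eq_comp_inl (hD : D.IsCovered) {f : B.toGRel ⟶ (C.disj D).toGRel}
    {g : (A.conj B).toGRel ⟶ C.toGRel} (h : snd A B ≫ f = g ≫ inl C D) :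
    ∃ k : B.toGRel ⟶ C.toGRel, f = k ≫ inl C D ∧ g = snd A B ≫ k := by
  obtain ⟨k, rfl⟩ := exists_eq_comp_inl hD f fun b d hbd => by
    have := (mem_snd_comp (A := A) f (Sum.inr b) _).2 ⟨b, rfl, hbd⟩
    rw [h, mem_comp_inl] at this
    simp at this
  exact ⟨k, rfl, comp_inl_cancel (B := D) (by rw [← h, Category.assoc])⟩

theorem snd_comp_eq_comp_inr (hC : C.IsCovered) {f : B.toGRel ⟶ (C.disj D).toGRel}
    {g : (A.conj B).toGRel ⟶ D.toGRel} (h : snd A B ≫ f = g ≫ inr C D) :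
    ∃ k : B.toGRel ⟶ D.toGRel, f = k ≫ inr C D ∧ g = snd A B ≫ k := by
  obtain ⟨k, rfl⟩ := exists_eq_comp_inr hC f fun b d hbd => by
    have := (mem_snd_comp (A := A) f (Sum.inr b) _).2 ⟨b, rfl, hbd⟩
    rw [h, mem_comp_inr] at this
    simp at this
  exact ⟨k, rfl, comp_inr_cancel (A := C) (by rw [← h, Category.assoc])⟩

end AbsProp

/-! ### The category of formulas -/

theorem Formula.toAbsProp_isCovered : ∀ φ : Formula K, φ.toAbsProp.IsCovered
  | atom k => AbsProp.vertex_isCovered k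
  | and φ ψ => φ.toAbsProp_isCovered.conj ψ.toAbsProp_isCovered
  | or φ ψ => φ.toAbsProp_isCovered.disj ψ.toAbsProp_isCovered

namespace CWStrict

/-- Conjunction of formulas, as an operation on objects. -/
abbrev and (φ ψ : CWStrict K) : CWStrict K := Formula.and φ ψ

/-- Disjunction of formulas, as an operation on objects. -/
abbrev or (φ ψ : CWStrict K) : CWStrict K := Formula.or φ ψ

/-- The first projection out of a conjunction. -/
abbrev fst (φ ψ : CWStrict K) : φ.and ψ ⟶ φ := (data K).fst φ ψ

/-- The second projection out of a conjunction. -/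
abbrev snd (φ ψ : CWStrict K) : φ.and ψ ⟶ ψ := (data K).snd φ ψ

/-- The first injection into a disjunction. -/
abbrev inl (φ ψ : CWStrict K) : φ ⟶ φ.or ψ := (data K).inl φ ψ

/-- The second injection into a disjunction. -/
abbrev inr (φ ψ : CWStrict K) : ψ ⟶ φ.or ψ := (data K).inr φ ψ

@[elab_as_elim]
theorem obj_induction {P : CWStrict K → Prop} (atom : ∀ k, P (gen k))
    (and : ∀ φ ψ, P φ → P ψ → P (and φ ψ)) (or : ∀ φ ψ, P φ → P ψ → P (or φ ψ)) (φ) : P φ :=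
  Formula.rec atom and or φ

theorem isCovered (φ : CWStrict K) : (Formula.toAbsProp φ).IsCovered :=
  Formula.toAbsProp_isCovered φ

section Hom

variable {φ ψ χ θ : CWStrict K}

theorem and_hom_ext {f g : χ ⟶ φ.and ψ} (h₁ : f ≫ fst φ ψ = g ≫ fst φ ψ)
    (h₂ : f ≫ snd φ ψ = g ≫ snd φ ψ) : f = g :=
  InducedCategory.hom_ext (AbsProp.conj_hom_ext (congrArg (·.hom) h₁) (congrArg (·.hom) h₂))

theorem or_hom_ext {f g : φ.or ψ ⟶ χ} (h₁ : inl φ ψ ≫ f = inl φ ψ ≫ g)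
    (h₂ : inr φ ψ ≫ f = inr φ ψ ≫ g) : f = g :=
  InducedCategory.hom_ext (AbsProp.disj_hom_ext (congrArg (·.hom) h₁) (congrArg (·.hom) h₂))

theorem exists_and_lift (f : χ ⟶ φ) (g : χ ⟶ ψ) :
    ∃ h : χ ⟶ φ.and ψ, h ≫ fst φ ψ = f ∧ h ≫ snd φ ψ = g := by
  obtain ⟨h, h₁, h₂⟩ := AbsProp.exists_conj_lift φ.isCovered ψ.isCovered f.hom g.hom
  exact ⟨InducedCategory.homMk h, InducedCategory.hom_ext h₁, InducedCategory.hom_ext h₂⟩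

theorem exists_or_desc (f : φ ⟶ χ) (g : ψ ⟶ χ) :
    ∃ h : φ.or ψ ⟶ χ, inl φ ψ ≫ h = f ∧ inr φ ψ ≫ h = g := by
  obtain ⟨h, h₁, h₂⟩ := AbsProp.exists_disj_desc φ.isCovered ψ.isCovered f.hom g.hom
  exact ⟨InducedCategory.homMk h, InducedCategory.hom_ext h₁, InducedCategory.hom_ext h₂⟩

theorem data_isProductSum : (data K).IsProductSum where
  isProduct _ _ := ⟨BinaryFan.isLimitMk
    (fun s => (exists_and_lift s.fst s.snd).choose)
    (fun s => (exists_and_lift s.fst s.snd).choose_spec.1)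
    (fun s => (exists_and_lift s.fst s.snd).choose_spec.2)
    (fun s _ h₁ h₂ => and_hom_ext
      (h₁.trans (exists_and_lift s.fst s.snd).choose_spec.1.symm)
      (h₂.trans (exists_and_lift s.fst s.snd).choose_spec.2.symm))⟩
  isSum _ _ := ⟨BinaryCofan.isColimitMk
    (fun s => (exists_or_desc s.inl s.inr).choose)
    (fun s => (exists_or_desc s.inl s.inr).choose_spec.1)
    (fun s => (exists_or_desc s.inl s.inr).choose_spec.2)
    (fun s _ h₁ h₂ => or_hom_ext
      (h₁.trans (exists_or_desc s.inl s.inr).choose_spec.1.symm)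
      (h₂.trans (exists_or_desc s.inl s.inr).choose_spec.2.symm))⟩

theorem and_or_factor (f : φ.and ψ ⟶ χ.or θ) :
    (∃ g, f = fst φ ψ ≫ g) ∨ (∃ g, f = snd φ ψ ≫ g) ∨
    (∃ g, f = g ≫ inl χ θ) ∨ (∃ g, f = g ≫ inr χ θ) := by
  obtain ⟨g, h⟩ | ⟨g, h⟩ | ⟨g, h⟩ | ⟨g, h⟩ :=
    AbsProp.conj_disj_factor φ.isCovered ψ.isCovered χ.isCovered θ.isCovered f.hom
  · exact .inl ⟨InducedCategory.homMk g, InducedCategory.hom_ext h⟩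
  · exact .inr (.inl ⟨InducedCategory.homMk g, InducedCategory.hom_ext h⟩)
  · exact .inr (.inr (.inl ⟨InducedCategory.homMk g, InducedCategory.hom_ext h⟩))
  · exact .inr (.inr (.inr ⟨InducedCategory.homMk g, InducedCategory.hom_ext h⟩))

theorem gen_or_factor {k : K} (f : gen k ⟶ χ.or θ) :
    (∃ g, f = g ≫ inl χ θ) ∨ (∃ g, f = g ≫ inr χ θ) := by
  obtain ⟨g, h⟩ | ⟨g, h⟩ := AbsProp.vertex_disj_factor k χ.isCovered θ.isCovered f.hom
  · exact .inl ⟨InducedCategory.homMk g, InducedCategory.hom_ext h⟩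
  · exact .inr ⟨InducedCategory.homMk g, InducedCategory.hom_ext h⟩

theorem and_gen_factor {k : K} (f : φ.and ψ ⟶ gen k) :
    (∃ g, f = fst φ ψ ≫ g) ∨ (∃ g, f = snd φ ψ ≫ g) := by
  obtain ⟨g, h⟩ | ⟨g, h⟩ := AbsProp.conj_vertex_factor k φ.isCovered ψ.isCovered f.hom
  · exact .inl ⟨InducedCategory.homMk g, InducedCategory.hom_ext h⟩
  · exact .inr ⟨InducedCategory.homMk g, InducedCategory.hom_ext h⟩

theorem gen_hom_label_eq {k l : K} (f : gen k ⟶ gen l) : k = l :=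
  AbsProp.vertex_hom_label_eq f.hom

theorem gen_hom_eq_id {k : K} (f : gen k ⟶ gen k) : f = 𝟙 _ :=
  InducedCategory.hom_ext (AbsProp.vertex_hom_eq_id f.hom)

theorem fst_comp_cancel {f g : φ ⟶ χ} (h : fst φ ψ ≫ f = fst φ ψ ≫ g) : f = g :=
  InducedCategory.hom_ext (AbsProp.fst_comp_cancel (congrArg (·.hom) h))

theorem snd_comp_cancel {f g : ψ ⟶ χ} (h : snd φ ψ ≫ f = snd φ ψ ≫ g) : f = g :=
  InducedCategory.hom_ext (AbsProp.snd_comp_cancel (congrArg (·.hom) h))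

theorem comp_inl_cancel {f g : χ ⟶ φ} (h : f ≫ inl φ ψ = g ≫ inl φ ψ) : f = g :=
  InducedCategory.hom_ext (AbsProp.comp_inl_cancel (congrArg (·.hom) h))

theorem comp_inr_cancel {f g : χ ⟶ ψ} (h : f ≫ inr φ ψ = g ≫ inr φ ψ) : f = g :=
  InducedCategory.hom_ext (AbsProp.comp_inr_cancel (congrArg (·.hom) h))

theorem comp_inl_ne_comp_inr (f : χ ⟶ φ) (g : χ ⟶ ψ) : f ≫ inl φ ψ ≠ g ≫ inr φ ψ := fun h =>
  AbsProp.comp_inl_ne_comp_inr χ.isCovered φ.isCovered _ _ (congrArg (·.hom) h)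

theorem fst_comp_ne_snd_comp (f : φ ⟶ χ) (g : ψ ⟶ χ) : fst φ ψ ≫ f ≠ snd φ ψ ≫ g := fun h =>
  AbsProp.fst_comp_ne_snd_comp φ.isCovered χ.isCovered _ _ (congrArg (·.hom) h)

theorem fst_comp_eq_comp_inl {f : φ ⟶ χ.or θ} {g : φ.and ψ ⟶ χ}
    (h : fst φ ψ ≫ f = g ≫ inl χ θ) : ∃ k, f = k ≫ inl χ θ ∧ g = fst φ ψ ≫ k := by
  obtain ⟨k, h₁, h₂⟩ := AbsProp.fst_comp_eq_comp_inl θ.isCovered (congrArg (·.hom) h)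
  exact ⟨InducedCategory.homMk k, InducedCategory.hom_ext h₁, InducedCategory.hom_ext h₂⟩

theorem fst_comp_eq_comp_inr {f : φ ⟶ χ.or θ} {g : φ.and ψ ⟶ θ}
    (h : fst φ ψ ≫ f = g ≫ inr χ θ) : ∃ k, f = k ≫ inr χ θ ∧ g = fst φ ψ ≫ k := by
  obtain ⟨k, h₁, h₂⟩ := AbsProp.fst_comp_eq_comp_inr χ.isCovered (congrArg (·.hom) h)
  exact ⟨InducedCategory.homMk k, InducedCategory.hom_ext h₁, InducedCategory.hom_ext h₂⟩

theorem snd_comp_eq_comp_inl {f : ψ ⟶ χ.or θ} {g : φ.and ψ ⟶ χ}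
    (h : snd φ ψ ≫ f = g ≫ inl χ θ) : ∃ k, f = k ≫ inl χ θ ∧ g = snd φ ψ ≫ k := by
  obtain ⟨k, h₁, h₂⟩ := AbsProp.snd_comp_eq_comp_inl θ.isCovered (congrArg (·.hom) h)
  exact ⟨InducedCategory.homMk k, InducedCategory.hom_ext h₁, InducedCategory.hom_ext h₂⟩

theorem snd_comp_eq_comp_inr {f : ψ ⟶ χ.or θ} {g : φ.and ψ ⟶ θ}
    (h : snd φ ψ ≫ f = g ≫ inr χ θ) : ∃ k, f = k ≫ inr χ θ ∧ g = snd φ ψ ≫ k := by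
  obtain ⟨k, h₁, h₂⟩ := AbsProp.snd_comp_eq_comp_inr χ.isCovered (congrArg (·.hom) h)
  exact ⟨InducedCategory.homMk k, InducedCategory.hom_ext h₁, InducedCategory.hom_ext h₂⟩

end Hom

/-! ### Induction on morphisms -/

/-- Induction on the morphisms into a fixed sum. -/
theorem hom_or_induction {χ θ : CWStrict K} {P : ∀ {φ : CWStrict K}, (φ ⟶ χ.or θ) → Prop}
    (copair : ∀ {φ ψ} (f : φ.or ψ ⟶ χ.or θ), P (inl φ ψ ≫ f) → P (inr φ ψ ≫ f) → P f)
    (fst : ∀ {φ} ψ (f : φ ⟶ χ.or θ), P f → P (fst φ ψ ≫ f))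
    (snd : ∀ φ {ψ} (f : ψ ⟶ χ.or θ), P f → P (snd φ ψ ≫ f))
    (inl : ∀ {φ} (f : φ ⟶ χ), P (f ≫ inl χ θ))
    (inr : ∀ {φ} (f : φ ⟶ θ), P (f ≫ inr χ θ)) :
    ∀ {φ} (f : φ ⟶ χ.or θ), P f := by
  intro φ
  induction φ using obj_induction with
  | atom k =>
    intro f
    obtain ⟨g, rfl⟩ | ⟨g, rfl⟩ := gen_or_factor f
    · exact inl g
    · exact inr g
  | and φ ψ ihφ ihψ =>
    intro f
    obtain ⟨g, rfl⟩ | ⟨g, rfl⟩ | ⟨g, rfl⟩ | ⟨g, rfl⟩ := and_or_factor f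
    · exact fst ψ g (ihφ g)
    · exact snd φ g (ihψ g)
    · exact inl g
    · exact inr g
  | or φ ψ ihφ ihψ => exact fun f => copair f (ihφ _) (ihψ _)

/-- Induction on all morphisms: they are generated from the identities of generators by pairing,
copairing, precomposition with projections and postcomposition with injections. This is the
cut-free presentation of the morphisms. -/
theorem hom_induction {P : ∀ {φ ψ : CWStrict K}, (φ ⟶ ψ) → Prop}
    (id : ∀ k, P (𝟙 (gen k)))
    (pair : ∀ {φ ψ χ} (f : φ ⟶ and ψ χ), P (f ≫ fst ψ χ) → P (f ≫ snd ψ χ) → P f)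
    (copair : ∀ {φ ψ χ} (f : or φ ψ ⟶ χ), P (inl φ ψ ≫ f) → P (inr φ ψ ≫ f) → P f)
    (fst : ∀ {φ} ψ {χ} (f : φ ⟶ χ), P f → P (fst φ ψ ≫ f))
    (snd : ∀ φ {ψ χ} (f : ψ ⟶ χ), P f → P (snd φ ψ ≫ f))
    (inl : ∀ {φ ψ} χ (f : φ ⟶ ψ), P f → P (f ≫ inl ψ χ))
    (inr : ∀ {φ} ψ {χ} (f : φ ⟶ χ), P f → P (f ≫ inr ψ χ)) :
    ∀ {φ ψ} (f : φ ⟶ ψ), P f := by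
  intro φ ψ
  induction ψ using obj_induction generalizing φ with
  | atom l =>
    induction φ using obj_induction with
    | atom k =>
      intro f
      obtain rfl := gen_hom_label_eq f
      rw [gen_hom_eq_id f]
      exact id k
    | and φ ψ ihφ ihψ =>
      intro f
      obtain ⟨g, rfl⟩ | ⟨g, rfl⟩ := and_gen_factor f
      · exact fst ψ g (ihφ g)
      · exact snd φ g (ihψ g)
    | or φ ψ ihφ ihψ => exact fun f => copair f (ihφ _) (ihψ _)
  | and ψ χ ihψ ihχ => exact fun f => pair f (ihψ _) (ihχ _)
  | or ψ χ ihψ ihχ =>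
    intro f
    exact hom_or_induction (P := P) copair (fun ψ f => fst ψ f) (fun φ _ f => snd φ f)
      (fun f => inl χ f (ihψ f)) (fun f => inr ψ f (ihχ f)) f

end CWStrict

/-! ### Chosen products and sums -/

namespace ProductSumData

variable {C : Type u₁} [Category.{v₁} C] {T : ProductSumData C}

theorem IsProductSum.prod_hom_ext (hT : T.IsProductSum) {X Y Z : C} {f g : Z ⟶ T.prod X Y}
    (h₁ : f ≫ T.fst X Y = g ≫ T.fst X Y) (h₂ : f ≫ T.snd X Y = g ≫ T.snd X Y) : f = g :=
  (hT.isProduct X Y).elim fun h => BinaryFan.IsLimit.hom_ext h h₁ h₂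

theorem IsProductSum.sum_hom_ext (hT : T.IsProductSum) {X Y Z : C} {f g : T.sum X Y ⟶ Z}
    (h₁ : T.inl X Y ≫ f = T.inl X Y ≫ g) (h₂ : T.inr X Y ≫ f = T.inr X Y ≫ g) : f = g :=
  (hT.isSum X Y).elim fun h => BinaryCofan.IsColimit.hom_ext h h₁ h₂

theorem IsProductSum.exists_lift (hT : T.IsProductSum) {X Y Z : C} (f : Z ⟶ X) (g : Z ⟶ Y) :
    ∃ h : Z ⟶ T.prod X Y, h ≫ T.fst X Y = f ∧ h ≫ T.snd X Y = g :=
  (hT.isProduct X Y).elim fun h =>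
    ⟨_, (BinaryFan.IsLimit.lift' h f g).2.1, (BinaryFan.IsLimit.lift' h f g).2.2⟩

theorem IsProductSum.exists_desc (hT : T.IsProductSum) {X Y Z : C} (f : X ⟶ Z) (g : Y ⟶ Z) :
    ∃ h : T.sum X Y ⟶ Z, T.inl X Y ≫ h = f ∧ T.inr X Y ≫ h = g :=
  (hT.isSum X Y).elim fun h =>
    ⟨_, (BinaryCofan.IsColimit.desc' h f g).2.1, (BinaryCofan.IsColimit.desc' h f g).2.2⟩

end ProductSumData

/-! ### The interpretation of formulas and morphisms -/

section Interp

variable {C : Type u₁} [Category.{v₁} C] (T : ProductSumData C) (v : K → C)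

/-- The interpretation of a formula by the chosen products and sums, with generators interpreted
by `v`. -/
def interpFormula : Formula K → C
  | .atom k => v k
  | .and φ ψ => T.prod (interpFormula φ) (interpFormula ψ)
  | .or φ ψ => T.sum (interpFormula φ) (interpFormula ψ)

/-- `interpFormula` as a function on the objects of the category of formulas. -/
def interp (φ : CWStrict K) : C := interpFormula T v φ

open CWLogic.CWStrict (gen and or fst snd inl inr)

/-- The chosen first projection, with its source typed as the interpretation of a formula. -/
def interpFst (φ ψ : CWStrict K) : interp T v (and φ ψ) ⟶ interp T v φ := T.fst _ _

/-- The chosen second projection, with its source typed as the interpretation of a formula. -/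
def interpSnd (φ ψ : CWStrict K) : interp T v (and φ ψ) ⟶ interp T v ψ := T.snd _ _

/-- The chosen first injection, with its target typed as the interpretation of a formula. -/
def interpInl (φ ψ : CWStrict K) : interp T v φ ⟶ interp T v (or φ ψ) := T.inl _ _

/-- The chosen second injection, with its target typed as the interpretation of a formula. -/
def interpInr (φ ψ : CWStrict K) : interp T v ψ ⟶ interp T v (or φ ψ) := T.inr _ _

/-- `IsInterp T v f g`: the morphism `g` of `C` interprets the morphism `f` of formulas. The rules
are those of the cut-free presentation of morphisms, so closure under composition is a theorem. -/
inductive IsInterp : ∀ {φ ψ : CWStrict K}, (φ ⟶ ψ) → (interp T v φ ⟶ interp T v ψ) → Prop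
  | id (k : K) : IsInterp (𝟙 (gen k)) (𝟙 _)
  | pair {φ ψ χ : CWStrict K} {f : φ ⟶ and ψ χ} {g : interp T v φ ⟶ interp T v (and ψ χ)} :
      IsInterp (f ≫ fst ψ χ) (g ≫ interpFst T v ψ χ) →
      IsInterp (f ≫ snd ψ χ) (g ≫ interpSnd T v ψ χ) → IsInterp f g
  | copair {φ ψ χ : CWStrict K} {f : or φ ψ ⟶ χ} {g : interp T v (or φ ψ) ⟶ interp T v χ} :
      IsInterp (inl φ ψ ≫ f) (interpInl T v φ ψ ≫ g) →
      IsInterp (inr φ ψ ≫ f) (interpInr T v φ ψ ≫ g) → IsInterp f g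
  | fst {φ χ : CWStrict K} (ψ : CWStrict K) {f : φ ⟶ χ} {g} : IsInterp f g →
      IsInterp (fst φ ψ ≫ f) (interpFst T v φ ψ ≫ g)
  | snd {ψ χ : CWStrict K} (φ : CWStrict K) {f : ψ ⟶ χ} {g} : IsInterp f g →
      IsInterp (snd φ ψ ≫ f) (interpSnd T v φ ψ ≫ g)
  | inl {φ ψ : CWStrict K} (χ : CWStrict K) {f : φ ⟶ ψ} {g} : IsInterp f g →
      IsInterp (f ≫ inl ψ χ) (g ≫ interpInl T v ψ χ)
  | inr {φ χ : CWStrict K} (ψ : CWStrict K) {f : φ ⟶ χ} {g} : IsInterp f g →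
      IsInterp (f ≫ inr ψ χ) (g ≫ interpInr T v ψ χ)

variable {T v}

theorem interp_and_hom_ext (hT : T.IsProductSum) {φ ψ : CWStrict K} {Z : C}
    {f g : Z ⟶ interp T v (and φ ψ)} (h₁ : f ≫ interpFst T v φ ψ = g ≫ interpFst T v φ ψ)
    (h₂ : f ≫ interpSnd T v φ ψ = g ≫ interpSnd T v φ ψ) : f = g :=
  hT.prod_hom_ext h₁ h₂

theorem interp_or_hom_ext (hT : T.IsProductSum) {φ ψ : CWStrict K} {Z : C}
    {f g : interp T v (or φ ψ) ⟶ Z} (h₁ : interpInl T v φ ψ ≫ f = interpInl T v φ ψ ≫ g)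
    (h₂ : interpInr T v φ ψ ≫ f = interpInr T v φ ψ ≫ g) : f = g :=
  hT.sum_hom_ext h₁ h₂

theorem exists_interp_and_lift (hT : T.IsProductSum) {φ ψ : CWStrict K} {Z : C}
    (f : Z ⟶ interp T v φ) (g : Z ⟶ interp T v ψ) : ∃ h : Z ⟶ interp T v (and φ ψ),
      h ≫ interpFst T v φ ψ = f ∧ h ≫ interpSnd T v φ ψ = g :=
  hT.exists_lift f g

theorem exists_interp_or_desc (hT : T.IsProductSum) {φ ψ : CWStrict K} {Z : C}
    (f : interp T v φ ⟶ Z) (g : interp T v ψ ⟶ Z) : ∃ h : interp T v (or φ ψ) ⟶ Z,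
      interpInl T v φ ψ ≫ h = f ∧ interpInr T v φ ψ ≫ h = g :=
  hT.exists_desc f g

namespace IsInterp

theorem exists_isInterp (hT : T.IsProductSum) :
    ∀ {φ ψ : CWStrict K} (f : φ ⟶ ψ), ∃ g, IsInterp T v f g := by
  intro φ ψ f
  induction f using CWStrict.hom_induction with
  | id k => exact ⟨_, .id k⟩
  | pair f h₁ h₂ =>
    obtain ⟨g₁, h₁⟩ := h₁
    obtain ⟨g₂, h₂⟩ := h₂
    obtain ⟨g, rfl, rfl⟩ := exists_interp_and_lift hT g₁ g₂
    exact ⟨g, .pair h₁ h₂⟩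
  | copair f h₁ h₂ =>
    obtain ⟨g₁, h₁⟩ := h₁
    obtain ⟨g₂, h₂⟩ := h₂
    obtain ⟨g, rfl, rfl⟩ := exists_interp_or_desc hT g₁ g₂
    exact ⟨g, .copair h₁ h₂⟩
  | fst ψ f h => exact h.elim fun g h => ⟨_, h.fst ψ⟩
  | snd φ f h => exact h.elim fun g h => ⟨_, h.snd φ⟩
  | inl χ f h => exact h.elim fun g h => ⟨_, h.inl χ⟩
  | inr ψ f h => exact h.elim fun g h => ⟨_, h.inr ψ⟩

/-- Inversion of the pairing rule: interpretations are compatible with projections, whichever rule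
comes last. -/
theorem comp_fst {φ ψ χ : CWStrict K} {f : φ ⟶ and ψ χ} {g} (h : IsInterp T v f g) :
    IsInterp T v (f ≫ CWStrict.fst ψ χ) (g ≫ interpFst T v ψ χ) := by
  induction φ using CWStrict.obj_induction with
  | atom k =>
    cases h with
    | pair h₁ h₂ => exact h₁
  | and α β ihα ihβ =>
    cases h with
    | pair h₁ h₂ => exact h₁
    | fst _ h =>
      rw [Category.assoc, Category.assoc]
      exact (ihα h).fst β
    | snd _ h =>
      rw [Category.assoc, Category.assoc]
      exact (ihβ h).snd α
  | or α β ihα ihβ =>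
    cases h with
    | pair h₁ h₂ => exact h₁
    | copair h₁ h₂ =>
      refine .copair ?_ ?_
      · simpa only [Category.assoc] using ihα h₁
      · simpa only [Category.assoc] using ihβ h₂

theorem comp_snd {φ ψ χ : CWStrict K} {f : φ ⟶ and ψ χ} {g} (h : IsInterp T v f g) :
    IsInterp T v (f ≫ CWStrict.snd ψ χ) (g ≫ interpSnd T v ψ χ) := by
  induction φ using CWStrict.obj_induction with
  | atom k =>
    cases h with
    | pair h₁ h₂ => exact h₂
  | and α β ihα ihβ =>
    cases h with
    | pair h₁ h₂ => exact h₂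
    | fst _ h =>
      rw [Category.assoc, Category.assoc]
      exact (ihα h).fst β
    | snd _ h =>
      rw [Category.assoc, Category.assoc]
      exact (ihβ h).snd α
  | or α β ihα ihβ =>
    cases h with
    | pair h₁ h₂ => exact h₂
    | copair h₁ h₂ =>
      refine .copair ?_ ?_
      · simpa only [Category.assoc] using ihα h₁
      · simpa only [Category.assoc] using ihβ h₂

/-- Inversion of the copairing rule: interpretations are compatible with injections, whichever rule
comes last. -/
theorem inl_comp {φ ψ χ : CWStrict K} {f : or φ ψ ⟶ χ} {g} (h : IsInterp T v f g) :
    IsInterp T v (CWStrict.inl φ ψ ≫ f) (interpInl T v φ ψ ≫ g) := by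
  induction χ using CWStrict.obj_induction with
  | atom k =>
    cases h with
    | copair h₁ h₂ => exact h₁
  | and α β ihα ihβ =>
    cases h with
    | copair h₁ h₂ => exact h₁
    | pair h₁ h₂ =>
      refine .pair ?_ ?_
      · simpa only [Category.assoc] using ihα h₁
      · simpa only [Category.assoc] using ihβ h₂
  | or α β ihα ihβ =>
    cases h with
    | copair h₁ h₂ => exact h₁
    | inl _ h =>
      rw [← Category.assoc, ← Category.assoc]
      exact (ihα h).inl β
    | inr _ h =>
      rw [← Category.assoc, ← Category.assoc]
      exact (ihβ h).inr α

theorem inr_comp {φ ψ χ : CWStrict K} {f : or φ ψ ⟶ χ} {g} (h : IsInterp T v f g) :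
    IsInterp T v (CWStrict.inr φ ψ ≫ f) (interpInr T v φ ψ ≫ g) := by
  induction χ using CWStrict.obj_induction with
  | atom k =>
    cases h with
    | copair h₁ h₂ => exact h₂
  | and α β ihα ihβ =>
    cases h with
    | copair h₁ h₂ => exact h₂
    | pair h₁ h₂ =>
      refine .pair ?_ ?_
      · simpa only [Category.assoc] using ihα h₁
      · simpa only [Category.assoc] using ihβ h₂
  | or α β ihα ihβ =>
    cases h with
    | copair h₁ h₂ => exact h₂
    | inl _ h =>
      rw [← Category.assoc, ← Category.assoc]
      exact (ihα h).inl β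
    | inr _ h =>
      rw [← Category.assoc, ← Category.assoc]
      exact (ihβ h).inr α

/-- Inversion of the injection rule: every interpretation of `f ≫ inl` is an interpretation of `f`
followed by the injection. If the last rule is a projection, softness makes the rules permute. -/
theorem exists_of_comp_inl (hT : T.IsProductSum) {φ ψ χ : CWStrict K} {f : φ ⟶ ψ} {g}
    (h : IsInterp T v (f ≫ CWStrict.inl ψ χ) g) :
    ∃ m, IsInterp T v f m ∧ g = m ≫ interpInl T v ψ χ := by
  induction φ using CWStrict.obj_induction with
  | atom k =>
    generalize e : f ≫ CWStrict.inl ψ χ = f' at h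
    cases h with
    | inl _ h =>
      obtain rfl := CWStrict.comp_inl_cancel e
      exact ⟨_, h, rfl⟩
    | inr _ h => exact absurd e (CWStrict.comp_inl_ne_comp_inr _ _)
  | and α β ihα ihβ =>
    generalize e : f ≫ CWStrict.inl ψ χ = f' at h
    cases h with
    | inl _ h =>
      obtain rfl := CWStrict.comp_inl_cancel e
      exact ⟨_, h, rfl⟩
    | inr _ h => exact absurd e (CWStrict.comp_inl_ne_comp_inr _ _)
    | fst _ h =>
      obtain ⟨k, rfl, rfl⟩ := CWStrict.fst_comp_eq_comp_inl e.symm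
      obtain ⟨m, hm, rfl⟩ := ihα h
      exact ⟨_, hm.fst β, (Category.assoc _ _ _).symm⟩
    | snd _ h =>
      obtain ⟨k, rfl, rfl⟩ := CWStrict.snd_comp_eq_comp_inl e.symm
      obtain ⟨m, hm, rfl⟩ := ihβ h
      exact ⟨_, hm.snd α, (Category.assoc _ _ _).symm⟩
  | or α β ihα ihβ =>
    have h₁ := h.inl_comp
    have h₂ := h.inr_comp
    rw [← Category.assoc] at h₁ h₂
    obtain ⟨m₁, hm₁, e₁⟩ := ihα h₁
    obtain ⟨m₂, hm₂, e₂⟩ := ihβ h₂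
    obtain ⟨m, rfl, rfl⟩ := exists_interp_or_desc hT m₁ m₂
    exact ⟨m, .copair hm₁ hm₂, interp_or_hom_ext hT
      (e₁.trans (Category.assoc _ _ _)) (e₂.trans (Category.assoc _ _ _))⟩

theorem exists_of_comp_inr (hT : T.IsProductSum) {φ ψ χ : CWStrict K} {f : φ ⟶ χ} {g}
    (h : IsInterp T v (f ≫ CWStrict.inr ψ χ) g) :
    ∃ m, IsInterp T v f m ∧ g = m ≫ interpInr T v ψ χ := by
  induction φ using CWStrict.obj_induction with
  | atom k =>
    generalize e : f ≫ CWStrict.inr ψ χ = f' at h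
    cases h with
    | inl _ h => exact absurd e.symm (CWStrict.comp_inl_ne_comp_inr _ _)
    | inr _ h =>
      obtain rfl := CWStrict.comp_inr_cancel e
      exact ⟨_, h, rfl⟩
  | and α β ihα ihβ =>
    generalize e : f ≫ CWStrict.inr ψ χ = f' at h
    cases h with
    | inl _ h => exact absurd e.symm (CWStrict.comp_inl_ne_comp_inr _ _)
    | inr _ h =>
      obtain rfl := CWStrict.comp_inr_cancel e
      exact ⟨_, h, rfl⟩
    | fst _ h =>
      obtain ⟨k, rfl, rfl⟩ := CWStrict.fst_comp_eq_comp_inr e.symm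
      obtain ⟨m, hm, rfl⟩ := ihα h
      exact ⟨_, hm.fst β, (Category.assoc _ _ _).symm⟩
    | snd _ h =>
      obtain ⟨k, rfl, rfl⟩ := CWStrict.snd_comp_eq_comp_inr e.symm
      obtain ⟨m, hm, rfl⟩ := ihβ h
      exact ⟨_, hm.snd α, (Category.assoc _ _ _).symm⟩
  | or α β ihα ihβ =>
    have h₁ := h.inl_comp
    have h₂ := h.inr_comp
    rw [← Category.assoc] at h₁ h₂
    obtain ⟨m₁, hm₁, e₁⟩ := ihα h₁
    obtain ⟨m₂, hm₂, e₂⟩ := ihβ h₂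
    obtain ⟨m, rfl, rfl⟩ := exists_interp_or_desc hT m₁ m₂
    exact ⟨m, .copair hm₁ hm₂, interp_or_hom_ext hT
      (e₁.trans (Category.assoc _ _ _)) (e₂.trans (Category.assoc _ _ _))⟩

/-- Inversion of the projection rule: every interpretation of `fst ≫ f` is the projection followed
by an interpretation of `f`. If the last rule is an injection, softness makes the rules permute. -/
theorem exists_of_fst_comp (hT : T.IsProductSum) {φ ψ χ : CWStrict K} {f : φ ⟶ χ} {g}
    (h : IsInterp T v (CWStrict.fst φ ψ ≫ f) g) :
    ∃ m, IsInterp T v f m ∧ g = interpFst T v φ ψ ≫ m := by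
  induction χ using CWStrict.obj_induction with
  | atom k =>
    generalize e : CWStrict.fst φ ψ ≫ f = f' at h
    cases h with
    | fst _ h =>
      obtain rfl := CWStrict.fst_comp_cancel e
      exact ⟨_, h, rfl⟩
    | snd _ h => exact absurd e (CWStrict.fst_comp_ne_snd_comp _ _)
  | or α β ihα ihβ =>
    generalize e : CWStrict.fst φ ψ ≫ f = f' at h
    cases h with
    | fst _ h =>
      obtain rfl := CWStrict.fst_comp_cancel e
      exact ⟨_, h, rfl⟩
    | snd _ h => exact absurd e (CWStrict.fst_comp_ne_snd_comp _ _)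
    | inl _ h =>
      obtain ⟨k, rfl, rfl⟩ := CWStrict.fst_comp_eq_comp_inl e
      obtain ⟨m, hm, rfl⟩ := ihα h
      exact ⟨_, hm.inl β, Category.assoc _ _ _⟩
    | inr _ h =>
      obtain ⟨k, rfl, rfl⟩ := CWStrict.fst_comp_eq_comp_inr e
      obtain ⟨m, hm, rfl⟩ := ihβ h
      exact ⟨_, hm.inr α, Category.assoc _ _ _⟩
  | and α β ihα ihβ =>
    have h₁ := h.comp_fst
    have h₂ := h.comp_snd
    rw [Category.assoc] at h₁ h₂
    obtain ⟨m₁, hm₁, e₁⟩ := ihα h₁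
    obtain ⟨m₂, hm₂, e₂⟩ := ihβ h₂
    obtain ⟨m, rfl, rfl⟩ := exists_interp_and_lift hT m₁ m₂
    exact ⟨m, .pair hm₁ hm₂, interp_and_hom_ext hT
      (e₁.trans (Category.assoc _ _ _).symm) (e₂.trans (Category.assoc _ _ _).symm)⟩

theorem exists_of_snd_comp (hT : T.IsProductSum) {φ ψ χ : CWStrict K} {f : ψ ⟶ χ} {g}
    (h : IsInterp T v (CWStrict.snd φ ψ ≫ f) g) :
    ∃ m, IsInterp T v f m ∧ g = interpSnd T v φ ψ ≫ m := by
  induction χ using CWStrict.obj_induction with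
  | atom k =>
    generalize e : CWStrict.snd φ ψ ≫ f = f' at h
    cases h with
    | fst _ h => exact absurd e.symm (CWStrict.fst_comp_ne_snd_comp _ _)
    | snd _ h =>
      obtain rfl := CWStrict.snd_comp_cancel e
      exact ⟨_, h, rfl⟩
  | or α β ihα ihβ =>
    generalize e : CWStrict.snd φ ψ ≫ f = f' at h
    cases h with
    | fst _ h => exact absurd e.symm (CWStrict.fst_comp_ne_snd_comp _ _)
    | snd _ h =>
      obtain rfl := CWStrict.snd_comp_cancel e
      exact ⟨_, h, rfl⟩
    | inl _ h =>
      obtain ⟨k, rfl, rfl⟩ := CWStrict.snd_comp_eq_comp_inl e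
      obtain ⟨m, hm, rfl⟩ := ihα h
      exact ⟨_, hm.inl β, Category.assoc _ _ _⟩
    | inr _ h =>
      obtain ⟨k, rfl, rfl⟩ := CWStrict.snd_comp_eq_comp_inr e
      obtain ⟨m, hm, rfl⟩ := ihβ h
      exact ⟨_, hm.inr α, Category.assoc _ _ _⟩
  | and α β ihα ihβ =>
    have h₁ := h.comp_fst
    have h₂ := h.comp_snd
    rw [Category.assoc] at h₁ h₂
    obtain ⟨m₁, hm₁, e₁⟩ := ihα h₁
    obtain ⟨m₂, hm₂, e₂⟩ := ihβ h₂
    obtain ⟨m, rfl, rfl⟩ := exists_interp_and_lift hT m₁ m₂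
    exact ⟨m, .pair hm₁ hm₂, interp_and_hom_ext hT
      (e₁.trans (Category.assoc _ _ _).symm) (e₂.trans (Category.assoc _ _ _).symm)⟩

/-- A morphism has at most one interpretation. Different cut-free presentations of the same
relation differ only by the permutations of rules that hold in every product-sum category. -/
theorem unique (hT : T.IsProductSum) {φ ψ : CWStrict K} (f : φ ⟶ ψ) :
    ∀ {g g'}, IsInterp T v f g → IsInterp T v f g' → g = g' := by
  induction f using CWStrict.hom_induction with
  | id k =>
    intro g g' h h'
    generalize 𝟙 (gen k) = f at h h'
    cases h
    cases h'
    rfl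
  | pair f h₁ h₂ =>
    exact fun h h' => interp_and_hom_ext hT (h₁ h.comp_fst h'.comp_fst) (h₂ h.comp_snd h'.comp_snd)
  | copair f h₁ h₂ =>
    exact fun h h' => interp_or_hom_ext hT (h₁ h.inl_comp h'.inl_comp) (h₂ h.inr_comp h'.inr_comp)
  | fst ψ f ih =>
    intro g g' h h'
    obtain ⟨m, hm, rfl⟩ := h.exists_of_fst_comp hT
    obtain ⟨m', hm', rfl⟩ := h'.exists_of_fst_comp hT
    rw [ih hm hm']
  | snd φ f ih =>
    intro g g' h h'
    obtain ⟨m, hm, rfl⟩ := h.exists_of_snd_comp hT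
    obtain ⟨m', hm', rfl⟩ := h'.exists_of_snd_comp hT
    rw [ih hm hm']
  | inl χ f ih =>
    intro g g' h h'
    obtain ⟨m, hm, rfl⟩ := h.exists_of_comp_inl hT
    obtain ⟨m', hm', rfl⟩ := h'.exists_of_comp_inl hT
    rw [ih hm hm']
  | inr ψ f ih =>
    intro g g' h h'
    obtain ⟨m, hm, rfl⟩ := h.exists_of_comp_inr hT
    obtain ⟨m', hm', rfl⟩ := h'.exists_of_comp_inr hT
    rw [ih hm hm']

theorem refl (φ : CWStrict K) : IsInterp T v (𝟙 φ) (𝟙 _) := by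
  induction φ using CWStrict.obj_induction with
  | atom k => exact .id k
  | and φ ψ hφ hψ =>
    refine .pair ?_ ?_
    · simpa only [Category.comp_id, Category.id_comp] using hφ.fst ψ
    · simpa only [Category.comp_id, Category.id_comp] using hψ.snd φ
  | or φ ψ hφ hψ =>
    refine .copair ?_ ?_
    · simpa only [Category.comp_id, Category.id_comp] using hφ.inl ψ
    · simpa only [Category.comp_id, Category.id_comp] using hψ.inr φ

/-- Composites of interpreted morphisms are interpreted by composites; this is cut elimination.
The outer induction is on the second factor. Only when that factor is a copairing is the first
factor inspected, by an inner induction on morphisms into a sum. -/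
theorem comp (hT : T.IsProductSum) {φ ψ χ : CWStrict K} {f : φ ⟶ ψ} {f' : ψ ⟶ χ} {g g'}
    (h : IsInterp T v f g) (h' : IsInterp T v f' g') : IsInterp T v (f ≫ f') (g ≫ g') := by
  induction f' using CWStrict.hom_induction generalizing φ with
  | id k =>
    obtain rfl := unique hT _ h' (refl _)
    simpa only [Category.comp_id] using h
  | pair f' h₁ h₂ =>
    refine .pair ?_ ?_
    · simpa only [Category.assoc] using h₁ h h'.comp_fst
    · simpa only [Category.assoc] using h₂ h h'.comp_snd
  | copair f' h₁ h₂ =>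
    induction f using CWStrict.hom_or_induction with
    | copair f ih₁ ih₂ =>
      refine .copair ?_ ?_
      · simpa only [Category.assoc] using ih₁ h.inl_comp
      · simpa only [Category.assoc] using ih₂ h.inr_comp
    | fst β f ih =>
      obtain ⟨m, hm, rfl⟩ := h.exists_of_fst_comp hT
      simpa only [Category.assoc] using (ih hm).fst β
    | snd α f ih =>
      obtain ⟨m, hm, rfl⟩ := h.exists_of_snd_comp hT
      simpa only [Category.assoc] using (ih hm).snd α
    | inl f =>
      obtain ⟨m, hm, rfl⟩ := h.exists_of_comp_inl hT
      simpa only [Category.assoc] using h₁ hm h'.inl_comp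
    | inr f =>
      obtain ⟨m, hm, rfl⟩ := h.exists_of_comp_inr hT
      simpa only [Category.assoc] using h₂ hm h'.inr_comp
  | fst β f' ih =>
    obtain ⟨m, hm, rfl⟩ := h'.exists_of_fst_comp hT
    simpa only [Category.assoc] using ih h.comp_fst hm
  | snd α f' ih =>
    obtain ⟨m, hm, rfl⟩ := h'.exists_of_snd_comp hT
    simpa only [Category.assoc] using ih h.comp_snd hm
  | inl β f' ih =>
    obtain ⟨m, hm, rfl⟩ := h'.exists_of_comp_inl hT
    simpa only [Category.assoc] using (ih h hm).inl β
  | inr α f' ih =>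
    obtain ⟨m, hm, rfl⟩ := h'.exists_of_comp_inr hT
    simpa only [Category.assoc] using (ih h hm).inr α

end IsInterp

variable (T v) in
/-- The functor that interprets formulas and their morphisms in a category with chosen products
and sums. -/
noncomputable def interpFunctor (hT : T.IsProductSum) : CWStrict K ⥤ C where
  obj := interp T v
  map f := (IsInterp.exists_isInterp hT f).choose
  map_id φ := IsInterp.unique hT _ (IsInterp.exists_isInterp hT _).choose_spec (.refl φ)
  map_comp f f' := IsInterp.unique hT _ (IsInterp.exists_isInterp hT _).choose_spec
    (.comp hT (IsInterp.exists_isInterp hT f).choose_spec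
      (IsInterp.exists_isInterp hT f').choose_spec)

theorem interpFunctor_map_eq (hT : T.IsProductSum) {φ ψ : CWStrict K} {f : φ ⟶ ψ} {g}
    (h : IsInterp T v f g) : (interpFunctor T v hT).map f = g :=
  IsInterp.unique hT f (IsInterp.exists_isInterp hT f).choose_spec h

theorem interpFunctor_strictlyPreserves (hT : T.IsProductSum) :
    StrictlyPreserves (CWStrict.data K) T (interpFunctor T v hT) where
  obj_prod _ _ := rfl
  obj_sum _ _ := rfl
  map_fst φ ψ := by
    refine (interpFunctor_map_eq hT (g := interpFst T v φ ψ) ?_).trans (Category.id_comp _).symm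
    simpa only [Category.comp_id] using (IsInterp.refl (T := T) (v := v) φ).fst ψ
  map_snd φ ψ := by
    refine (interpFunctor_map_eq hT (g := interpSnd T v φ ψ) ?_).trans (Category.id_comp _).symm
    simpa only [Category.comp_id] using (IsInterp.refl (T := T) (v := v) ψ).snd φ
  map_inl φ ψ := by
    refine (interpFunctor_map_eq hT (g := interpInl T v φ ψ) ?_).trans (Category.comp_id _).symm
    simpa only [Category.id_comp] using (IsInterp.refl (T := T) (v := v) φ).inl ψ
  map_inr φ ψ := by
    refine (interpFunctor_map_eq hT (g := interpInr T v φ ψ) ?_).trans (Category.comp_id _).symm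
    simpa only [Category.id_comp] using (IsInterp.refl (T := T) (v := v) ψ).inr φ

end Interp

/-! ### Functors preserving products and sums, and their natural transformations -/

section Functors

variable {C : Type u₁} [Category.{v₁} C]

open CWLogic.CWStrict (gen and or fst snd inl inr)

/-- A functor on formulas sends `∧` and `∨`, with their projections and injections, to products
and sums. -/
structure PreservesFormulas (F : CWStrict K ⥤ C) : Prop where
  and : ∀ φ ψ, Nonempty (IsLimit (BinaryFan.mk (F.map (fst φ ψ)) (F.map (snd φ ψ))))
  or : ∀ φ ψ, Nonempty (IsColimit (BinaryCofan.mk (F.map (inl φ ψ)) (F.map (inr φ ψ))))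

theorem preservesFormulas_of_productSumFunctor {F : CWStrict K ⥤ C}
    (hF : productSumFunctor (CWStrict K) C F) : PreservesFormulas F := by
  obtain ⟨_, _⟩ := hF
  exact
    { and := fun φ ψ => (CWStrict.data_isProductSum.isProduct φ ψ).map
        (mapIsLimitOfPreservesOfIsLimit F _ _)
      or := fun φ ψ => (CWStrict.data_isProductSum.isSum φ ψ).map
        (mapIsColimitOfPreservesOfIsColimit F _ _) }

namespace PreservesFormulas

variable {F G : CWStrict K ⥤ C}

theorem productSumFunctor (hF : PreservesFormulas F) :
    productSumFunctor (CWStrict K) C F := by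
  constructor
  · refine ⟨fun {D} => ?_⟩
    obtain ⟨h⟩ := CWStrict.data_isProductSum.isProduct (D.obj ⟨.left⟩) (D.obj ⟨.right⟩)
    obtain ⟨h'⟩ := hF.and (D.obj ⟨.left⟩) (D.obj ⟨.right⟩)
    have := preservesLimit_of_preserves_limit_cone h ((isLimitMapConeBinaryFanEquiv F _ _).symm h')
    exact preservesLimit_of_iso_diagram F (diagramIsoPair D).symm
  · refine ⟨fun {D} => ?_⟩
    obtain ⟨h⟩ := CWStrict.data_isProductSum.isSum (D.obj ⟨.left⟩) (D.obj ⟨.right⟩)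
    obtain ⟨h'⟩ := hF.or (D.obj ⟨.left⟩) (D.obj ⟨.right⟩)
    have := preservesColimit_of_preserves_colimit_cocone h
      ((isColimitMapCoconeBinaryCofanEquiv F _ _).symm h')
    exact preservesColimit_of_iso_diagram F (diagramIsoPair D).symm

theorem hom_ext_and (hF : PreservesFormulas F) {φ ψ : CWStrict K} {Z : C}
    {f g : Z ⟶ F.obj (CWStrict.and φ ψ)} (h₁ : f ≫ F.map (fst φ ψ) = g ≫ F.map (fst φ ψ))
    (h₂ : f ≫ F.map (snd φ ψ) = g ≫ F.map (snd φ ψ)) : f = g :=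
  (hF.and φ ψ).elim fun h => BinaryFan.IsLimit.hom_ext h h₁ h₂

theorem hom_ext_or (hF : PreservesFormulas F) {φ ψ : CWStrict K} {Z : C}
    {f g : F.obj (CWStrict.or φ ψ) ⟶ Z} (h₁ : F.map (inl φ ψ) ≫ f = F.map (inl φ ψ) ≫ g)
    (h₂ : F.map (inr φ ψ) ≫ f = F.map (inr φ ψ) ≫ g) : f = g :=
  (hF.or φ ψ).elim fun h => BinaryCofan.IsColimit.hom_ext h h₁ h₂

theorem exists_lift (hF : PreservesFormulas F) {φ ψ : CWStrict K} {Z : C}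
    (f : Z ⟶ F.obj φ) (g : Z ⟶ F.obj ψ) : ∃ h : Z ⟶ F.obj (CWStrict.and φ ψ),
      h ≫ F.map (fst φ ψ) = f ∧ h ≫ F.map (snd φ ψ) = g :=
  (hF.and φ ψ).elim fun h =>
    ⟨_, (BinaryFan.IsLimit.lift' h f g).2.1, (BinaryFan.IsLimit.lift' h f g).2.2⟩

theorem exists_desc (hF : PreservesFormulas F) {φ ψ : CWStrict K} {Z : C}
    (f : F.obj φ ⟶ Z) (g : F.obj ψ ⟶ Z) : ∃ h : F.obj (CWStrict.or φ ψ) ⟶ Z,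
      F.map (inl φ ψ) ≫ h = f ∧ F.map (inr φ ψ) ≫ h = g :=
  (hF.or φ ψ).elim fun h =>
    ⟨_, (BinaryCofan.IsColimit.desc' h f g).2.1, (BinaryCofan.IsColimit.desc' h f g).2.2⟩

/-- Naturality with respect to projections and injections implies naturality, because these
generate all morphisms by pairing and copairing. -/
theorem naturality (hF : PreservesFormulas F) (hG : PreservesFormulas G)
    (α : ∀ φ, F.obj φ ⟶ G.obj φ)
    (hfst : ∀ φ ψ, F.map (fst φ ψ) ≫ α φ = α (CWStrict.and φ ψ) ≫ G.map (fst φ ψ))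
    (hsnd : ∀ φ ψ, F.map (snd φ ψ) ≫ α ψ = α (CWStrict.and φ ψ) ≫ G.map (snd φ ψ))
    (hinl : ∀ φ ψ, F.map (inl φ ψ) ≫ α (CWStrict.or φ ψ) = α φ ≫ G.map (inl φ ψ))
    (hinr : ∀ φ ψ, F.map (inr φ ψ) ≫ α (CWStrict.or φ ψ) = α ψ ≫ G.map (inr φ ψ))
    {φ ψ : CWStrict K} (f : φ ⟶ ψ) : F.map f ≫ α ψ = α φ ≫ G.map f := by
  induction f using CWStrict.hom_induction with
  | id k => rw [F.map_id, G.map_id, Category.id_comp, Category.comp_id]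
  | pair f h₁ h₂ =>
    refine hG.hom_ext_and ?_ ?_
    · rw [Category.assoc, Category.assoc, ← hfst, ← F.map_comp_assoc, h₁, G.map_comp]
    · rw [Category.assoc, Category.assoc, ← hsnd, ← F.map_comp_assoc, h₂, G.map_comp]
  | copair f h₁ h₂ =>
    refine hF.hom_ext_or ?_ ?_
    · rw [← F.map_comp_assoc, h₁, G.map_comp, ← Category.assoc, ← hinl, Category.assoc]
    · rw [← F.map_comp_assoc, h₂, G.map_comp, ← Category.assoc, ← hinr, Category.assoc]
  | fst ψ f h => rw [F.map_comp, G.map_comp, Category.assoc, h, ← Category.assoc, hfst,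
      Category.assoc]
  | snd φ f h => rw [F.map_comp, G.map_comp, Category.assoc, h, ← Category.assoc, hsnd,
      Category.assoc]
  | inl χ f h => rw [F.map_comp, G.map_comp, Category.assoc, hinl, ← Category.assoc, h,
      Category.assoc]
  | inr ψ f h => rw [F.map_comp, G.map_comp, Category.assoc, hinr, ← Category.assoc, h,
      Category.assoc]

theorem natTrans_ext (hF : PreservesFormulas F) (hG : PreservesFormulas G) {α β : F ⟶ G}
    (h : ∀ k, α.app (gen k) = β.app (gen k)) : α = β := by
  ext φ
  induction φ using CWStrict.obj_induction with
  | atom k => exact h k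
  | and φ ψ hφ hψ =>
    refine hG.hom_ext_and ?_ ?_
    · rw [← α.naturality, ← β.naturality, hφ]
    · rw [← α.naturality, ← β.naturality, hψ]
  | or φ ψ hφ hψ =>
    refine hF.hom_ext_or ?_ ?_
    · rw [α.naturality, β.naturality, hφ]
    · rw [α.naturality, β.naturality, hψ]

/-- The extension of a family of morphisms from generators to all formulas. -/
noncomputable def extend (hF : PreservesFormulas F) (hG : PreservesFormulas G)
    (α : ∀ k, F.obj (gen k) ⟶ G.obj (gen k)) : ∀ φ : Formula K, F.obj φ ⟶ G.obj φ
  | .atom k => α k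
  | .and φ ψ => (hG.exists_lift (F.map (fst φ ψ) ≫ hF.extend hG α φ)
      (F.map (snd φ ψ) ≫ hF.extend hG α ψ)).choose
  | .or φ ψ => (hF.exists_desc (hF.extend hG α φ ≫ G.map (inl φ ψ))
      (hF.extend hG α ψ ≫ G.map (inr φ ψ))).choose

theorem exists_natTrans (hF : PreservesFormulas F) (hG : PreservesFormulas G)
    (α : ∀ k, F.obj (gen k) ⟶ G.obj (gen k)) :
    ∃ β : F ⟶ G, ∀ k, β.app (gen k) = α k :=
  ⟨{ app := hF.extend hG α
     naturality := fun _ _ f => hF.naturality hG (hF.extend hG α)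
      (fun _ _ => (hG.exists_lift _ _).choose_spec.1.symm)
      (fun _ _ => (hG.exists_lift _ _).choose_spec.2.symm)
      (fun _ _ => (hF.exists_desc _ _).choose_spec.1)
      (fun _ _ => (hF.exists_desc _ _).choose_spec.2) f }, fun _ => rfl⟩

end PreservesFormulas

/-! ### Strict preservation -/

theorem StrictlyPreserves.preservesFormulas {T : ProductSumData C} (hT : T.IsProductSum)
    {F : CWStrict K ⥤ C} (hF : StrictlyPreserves (CWStrict.data K) T F) :
    PreservesFormulas F where
  and φ ψ := by
    have key : ∀ {P X Y : C} (h : P = T.prod X Y),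
        Nonempty (IsLimit (BinaryFan.mk (eqToHom h ≫ T.fst X Y) (eqToHom h ≫ T.snd X Y))) := by
      rintro _ X Y rfl
      simpa only [eqToHom_refl, Category.id_comp] using hT.isProduct X Y
    have h := key (hF.obj_prod φ ψ)
    rwa [← hF.map_fst, ← hF.map_snd] at h
  or φ ψ := by
    have key : ∀ {P X Y : C} (h : T.sum X Y = P),
        Nonempty (IsColimit
          (BinaryCofan.mk (T.inl X Y ≫ eqToHom h) (T.inr X Y ≫ eqToHom h))) := by
      rintro _ X Y rfl
      simpa only [eqToHom_refl, Category.comp_id] using hT.isSum X Y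
    have h := key (hF.obj_sum φ ψ).symm
    rwa [← hF.map_inl, ← hF.map_inr] at h

namespace ProductSumData

variable (T : ProductSumData C) {X X' Y Y' Z Z' : C}

theorem fst_eqToHom (hX : X = X') (hY : Y = Y') (h : Z = Z')
    (hZ : Z = T.prod X Y) (hZ' : Z' = T.prod X' Y') :
    (eqToHom hZ ≫ T.fst X Y) ≫ eqToHom hX = eqToHom h ≫ eqToHom hZ' ≫ T.fst X' Y' := by
  subst hX hY hZ hZ'
  simp

theorem snd_eqToHom (hX : X = X') (hY : Y = Y') (h : Z = Z')
    (hZ : Z = T.prod X Y) (hZ' : Z' = T.prod X' Y') :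
    (eqToHom hZ ≫ T.snd X Y) ≫ eqToHom hY = eqToHom h ≫ eqToHom hZ' ≫ T.snd X' Y' := by
  subst hX hY hZ hZ'
  simp

theorem inl_eqToHom (hX : X = X') (hY : Y = Y') (h : Z = Z')
    (hZ : T.sum X Y = Z) (hZ' : T.sum X' Y' = Z') :
    (T.inl X Y ≫ eqToHom hZ) ≫ eqToHom h = eqToHom hX ≫ T.inl X' Y' ≫ eqToHom hZ' := by
  subst hX hY hZ hZ'
  simp

theorem inr_eqToHom (hX : X = X') (hY : Y = Y') (h : Z = Z')
    (hZ : T.sum X Y = Z) (hZ' : T.sum X' Y' = Z') :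
    (T.inr X Y ≫ eqToHom hZ) ≫ eqToHom h = eqToHom hY ≫ T.inr X' Y' ≫ eqToHom hZ' := by
  subst hX hY hZ hZ'
  simp

end ProductSumData

/-- Two strict functors that agree on generators agree on objects by induction on formulas, and
then on morphisms because the identifications `eqToHom` of their values are natural. -/
theorem StrictlyPreserves.functor_eq {T : ProductSumData C} (hT : T.IsProductSum)
    {F G : CWStrict K ⥤ C} (hF : StrictlyPreserves (CWStrict.data K) T F)
    (hG : StrictlyPreserves (CWStrict.data K) T G)
    (h : ∀ k, F.obj (gen k) = G.obj (gen k)) : F = G := by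
  have hobj : ∀ φ, F.obj φ = G.obj φ := by
    intro φ
    induction φ using CWStrict.obj_induction with
    | atom k => exact h k
    | and φ ψ hφ hψ => exact (hF.obj_prod φ ψ).trans (by rw [hφ, hψ]; exact (hG.obj_prod φ ψ).symm)
    | or φ ψ hφ hψ => exact (hF.obj_sum φ ψ).trans (by rw [hφ, hψ]; exact (hG.obj_sum φ ψ).symm)
  refine CategoryTheory.Functor.ext hobj fun φ ψ f => ?_
  have hnat := PreservesFormulas.naturality (hF.preservesFormulas hT) (hG.preservesFormulas hT)
    (fun φ => eqToHom (hobj φ))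
    (fun φ ψ => (congrArg (· ≫ eqToHom (hobj φ)) (hF.map_fst φ ψ)).trans
      ((T.fst_eqToHom (hobj φ) (hobj ψ) (hobj (and φ ψ)) _ _).trans
        (congrArg (eqToHom (hobj (and φ ψ)) ≫ ·) (hG.map_fst φ ψ)).symm))
    (fun φ ψ => (congrArg (· ≫ eqToHom (hobj ψ)) (hF.map_snd φ ψ)).trans
      ((T.snd_eqToHom (hobj φ) (hobj ψ) (hobj (and φ ψ)) _ _).trans
        (congrArg (eqToHom (hobj (and φ ψ)) ≫ ·) (hG.map_snd φ ψ)).symm))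
    (fun φ ψ => (congrArg (· ≫ eqToHom (hobj (or φ ψ))) (hF.map_inl φ ψ)).trans
      ((T.inl_eqToHom (hobj φ) (hobj ψ) (hobj (or φ ψ)) _ _).trans
        (congrArg (eqToHom (hobj φ) ≫ ·) (hG.map_inl φ ψ)).symm))
    (fun φ ψ => (congrArg (· ≫ eqToHom (hobj (or φ ψ))) (hF.map_inr φ ψ)).trans
      ((T.inr_eqToHom (hobj φ) (hobj ψ) (hobj (or φ ψ)) _ _).trans
        (congrArg (eqToHom (hobj ψ) ≫ ·) (hG.map_inr φ ψ)).symm)) f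
  rw [← Category.assoc, ← hnat, Category.assoc, eqToHom_trans, eqToHom_refl, Category.comp_id]

end Functors

/-! ### Resolutions of a formula are the maximal stable sets of its graph -/

theorem maximal_preimage_inl_inr {X Y : Type u} (P : Set X → Prop) (Q : Set Y → Prop)
    (t : Set (X ⊕ Y)) :
    Maximal (fun t : Set (X ⊕ Y) => P (Sum.inl ⁻¹' t) ∧ Q (Sum.inr ⁻¹' t)) t ↔
      Maximal P (Sum.inl ⁻¹' t) ∧ Maximal Q (Sum.inr ⁻¹' t) := by
  constructor
  · rintro ⟨⟨hP, hQ⟩, hmax⟩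
    refine ⟨⟨hP, fun a ha hle x hx => ?_⟩, ⟨hQ, fun b hb hle y hy => ?_⟩⟩
    · have hsub : t ≤ Sum.inl '' a ∪ Sum.inr '' (Sum.inr ⁻¹' t) := by
        rintro (x | y) h
        · exact Or.inl ⟨x, hle h, rfl⟩
        · exact Or.inr ⟨y, h, rfl⟩
      refine hmax ?_ hsub (Or.inl ⟨x, hx, rfl⟩)
      simpa [Set.preimage_union, Set.preimage_image_eq _ Sum.inl_injective,
        Set.preimage_image_eq _ Sum.inr_injective] using And.intro ha hQ
    · have hsub : t ≤ Sum.inl '' (Sum.inl ⁻¹' t) ∪ Sum.inr '' b := by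
        rintro (x | y) h
        · exact Or.inl ⟨x, h, rfl⟩
        · exact Or.inr ⟨y, hle h, rfl⟩
      refine hmax ?_ hsub (Or.inr ⟨y, hy, rfl⟩)
      simpa [Set.preimage_union, Set.preimage_image_eq _ Sum.inl_injective,
        Set.preimage_image_eq _ Sum.inr_injective] using And.intro hP hb
  · rintro ⟨⟨hP, hPmax⟩, ⟨hQ, hQmax⟩⟩
    refine ⟨⟨hP, hQ⟩, ?_⟩
    rintro t' ⟨hP', hQ'⟩ hle (x | y) h
    · exact hPmax hP' (fun _ hx => hle hx) h
    · exact hQmax hQ' (fun _ hy => hle hy) h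

/-- The singletons exclude that `∅`, the only set in the image of both injections, is maximal on
one side. -/
theorem maximal_image_inl_or_inr {X Y : Type u} {P : Set X → Prop} {Q : Set Y → Prop}
    (hP : ∃ x, P {x}) (hQ : ∃ y, Q {y}) (t : Set (X ⊕ Y)) :
    Maximal (fun t : Set (X ⊕ Y) => (∃ a, P a ∧ t = Sum.inl '' a) ∨
      (∃ b, Q b ∧ t = Sum.inr '' b)) t ↔
      (∃ a, Maximal P a ∧ t = Sum.inl '' a) ∨ (∃ b, Maximal Q b ∧ t = Sum.inr '' b) := by
  constructor
  · rintro ⟨⟨a, ha, rfl⟩ | ⟨b, hb, rfl⟩, hmax⟩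
    · refine Or.inl ⟨a, ⟨ha, fun a' ha' hle => ?_⟩, rfl⟩
      exact (Set.image_subset_image_iff Sum.inl_injective).1
        (hmax (Or.inl ⟨a', ha', rfl⟩) (Set.image_mono hle))
    · refine Or.inr ⟨b, ⟨hb, fun b' hb' hle => ?_⟩, rfl⟩
      exact (Set.image_subset_image_iff Sum.inr_injective).1
        (hmax (Or.inr ⟨b', hb', rfl⟩) (Set.image_mono hle))
  · rintro (⟨a, ha, rfl⟩ | ⟨b, hb, rfl⟩)
    · refine ⟨Or.inl ⟨a, ha.1, rfl⟩, ?_⟩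
      rintro _ (⟨a', ha', rfl⟩ | ⟨b, -, rfl⟩) hle
      · exact Set.image_mono (ha.2 ha' ((Set.image_subset_image_iff Sum.inl_injective).1 hle))
      · -- the inclusion forces `a = ∅`, which is not maximal since some singleton satisfies `P`
        obtain ⟨x, hx⟩ := hP
        have hxa : x ∈ a := by
          refine ha.2 hx (fun y hy => ?_) rfl
          obtain ⟨_, -, h⟩ := hle ⟨y, hy, rfl⟩
          cases h
        obtain ⟨_, -, h⟩ := hle ⟨x, hxa, rfl⟩
        cases h
    · refine ⟨Or.inr ⟨b, hb.1, rfl⟩, ?_⟩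
      rintro _ (⟨a, -, rfl⟩ | ⟨b', hb', rfl⟩) hle
      · obtain ⟨y, hy⟩ := hQ
        have hyb : y ∈ b := by
          refine hb.2 hy (fun x hx => ?_) rfl
          obtain ⟨_, -, h⟩ := hle ⟨x, hx, rfl⟩
          cases h
        obtain ⟨_, -, h⟩ := hle ⟨y, hyb, rfl⟩
        cases h
      · exact Set.image_mono (hb.2 hb' ((Set.image_subset_image_iff Sum.inr_injective).1 hle))

namespace Formula

theorem isIndepSet_or (φ ψ : Formula K) (t : Set (φ.Leaf ⊕ ψ.Leaf)) :
    (or φ ψ).graph.IsIndepSet t ↔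
      φ.graph.IsIndepSet (Sum.inl ⁻¹' t) ∧ ψ.graph.IsIndepSet (Sum.inr ⁻¹' t) := by
  constructor
  · intro h
    refine ⟨fun x hx y hy hne => ?_, fun x hx y hy hne => ?_⟩
    · exact h (x := Sum.inl x) hx (y := Sum.inl y) hy (fun e => hne (Sum.inl_injective e))
    · exact h (x := Sum.inr x) hx (y := Sum.inr y) hy (fun e => hne (Sum.inr_injective e))
  · rintro ⟨h₁, h₂⟩ (x | x) hx (y | y) hy hne
    · exact h₁ hx hy (fun e => hne (congrArg Sum.inl e))
    · exact id
    · exact id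
    · exact h₂ hx hy (fun e => hne (congrArg Sum.inr e))

theorem isIndepSet_and (φ ψ : Formula K) (t : Set (φ.Leaf ⊕ ψ.Leaf)) :
    (and φ ψ).graph.IsIndepSet t ↔ (∃ a, φ.graph.IsIndepSet a ∧ t = Sum.inl '' a) ∨
      (∃ b, ψ.graph.IsIndepSet b ∧ t = Sum.inr '' b) := by
  constructor
  · intro h
    have h₁ : φ.graph.IsIndepSet (Sum.inl ⁻¹' t) := fun x hx y hy hne =>
      h (x := Sum.inl x) hx (y := Sum.inl y) hy (fun e => hne (Sum.inl_injective e))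
    have h₂ : ψ.graph.IsIndepSet (Sum.inr ⁻¹' t) := fun x hx y hy hne =>
      h (x := Sum.inr x) hx (y := Sum.inr y) hy (fun e => hne (Sum.inr_injective e))
    by_cases hne : ∃ y, Sum.inr y ∈ t
    · obtain ⟨y, hy⟩ := hne
      refine Or.inr ⟨_, h₂, ?_⟩
      ext (x | z)
      · refine iff_of_false (fun hx => ?_) (by simp)
        exact h (x := Sum.inl x) hx (y := Sum.inr y) hy Sum.inl_ne_inr trivial
      · simp
    · refine Or.inl ⟨_, h₁, ?_⟩
      ext (x | z)
      · simp
      · exact iff_of_false (fun hz => hne ⟨z, hz⟩) (by simp)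
  · rintro (⟨a, ha, rfl⟩ | ⟨b, hb, rfl⟩)
    · rintro _ ⟨x, hx, rfl⟩ _ ⟨y, hy, rfl⟩ hne
      exact ha hx hy (fun e => hne (congrArg Sum.inl e))
    · rintro _ ⟨x, hx, rfl⟩ _ ⟨y, hy, rfl⟩ hne
      exact hb hx hy (fun e => hne (congrArg Sum.inr e))

/-- The leaves of the proposition generated along a formula are the leaves of the formula. -/
def leafEquiv : (φ : Formula K) → φ.toAbsProp.Leaf ≃ φ.Leaf
  | atom _ => Equiv.refl PUnit
  | and φ ψ => Equiv.sumCongr φ.leafEquiv ψ.leafEquiv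
  | or φ ψ => Equiv.sumCongr φ.leafEquiv ψ.leafEquiv

theorem label_leafEquiv : ∀ (φ : Formula K) (x : φ.toAbsProp.Leaf),
    φ.label (φ.leafEquiv x) = φ.toAbsProp.label x
  | atom _, _ => rfl
  | and φ _, .inl x => φ.label_leafEquiv x
  | and _ ψ, .inr x => ψ.label_leafEquiv x
  | or φ _, .inl x => φ.label_leafEquiv x
  | or _ ψ, .inr x => ψ.label_leafEquiv x

theorem exists_isIndepSet_singleton (φ : Formula K) : ∃ x, φ.graph.IsIndepSet {x} :=
  φ.toAbsProp_isCovered.nonempty.elim fun x => ⟨φ.leafEquiv x, Set.pairwise_singleton _ _⟩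

theorem mem_res_iff_maximal (φ : Formula K) (s : Set φ.toAbsProp.Leaf) :
    s ∈ φ.toAbsProp.res ↔ Maximal (fun t => φ.graph.IsIndepSet t) (φ.leafEquiv '' s) := by
  induction φ with
  | atom k =>
    have hind : ∀ t : Set (atom k).Leaf, (atom k).graph.IsIndepSet t := fun _ _ _ _ _ _ h => h
    have himg : (atom k).leafEquiv '' s = s := Set.image_id s
    have key : s ∈ (atom k).toAbsProp.res ↔ s = Set.univ := Iff.rfl
    rw [key, himg]
    exact ⟨fun h => ⟨hind _, fun t _ _ x _ => h ▸ trivial⟩,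
      fun h => Set.eq_univ_of_univ_subset (h.2 (hind _) (Set.subset_univ _))⟩
  | and φ ψ ihφ ihψ =>
    have hfun : (fun t => (and φ ψ).graph.IsIndepSet t) = fun t : Set (φ.Leaf ⊕ ψ.Leaf) =>
        (∃ a, φ.graph.IsIndepSet a ∧ t = Sum.inl '' a) ∨
        (∃ b, ψ.graph.IsIndepSet b ∧ t = Sum.inr '' b) :=
      funext fun t => propext (isIndepSet_and φ ψ t)
    have hinl : ∀ a : Set φ.toAbsProp.Leaf, Sum.map φ.leafEquiv ψ.leafEquiv '' (Sum.inl '' a) =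
        Sum.inl '' (φ.leafEquiv '' a) := fun a => by simp [Set.image_image]
    have hinr : ∀ b : Set ψ.toAbsProp.Leaf, Sum.map φ.leafEquiv ψ.leafEquiv '' (Sum.inr '' b) =
        Sum.inr '' (ψ.leafEquiv '' b) := fun b => by simp [Set.image_image]
    have hinj : Function.Injective (Sum.map φ.leafEquiv ψ.leafEquiv) :=
      (Equiv.sumCongr φ.leafEquiv ψ.leafEquiv).injective
    rw [hfun]
    refine (AbsProp.mem_res_conj φ.toAbsProp_isCovered ψ.toAbsProp_isCovered s).trans
      (Iff.trans ?_ (maximal_image_inl_or_inr φ.exists_isIndepSet_singleton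
        ψ.exists_isIndepSet_singleton (Sum.map φ.leafEquiv ψ.leafEquiv '' s)).symm)
    refine or_congr ⟨?_, ?_⟩ ⟨?_, ?_⟩
    · rintro ⟨a, ha, rfl⟩
      exact ⟨_, (ihφ a).1 ha, hinl a⟩
    · rintro ⟨a, ha, h⟩
      refine ⟨φ.leafEquiv ⁻¹' a, (ihφ _).2 ?_, hinj.image_injective ?_⟩
      · rwa [Equiv.image_preimage]
      · rw [h, hinl, Equiv.image_preimage]
    · rintro ⟨b, hb, rfl⟩
      exact ⟨_, (ihψ b).1 hb, hinr b⟩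
    · rintro ⟨b, hb, h⟩
      refine ⟨ψ.leafEquiv ⁻¹' b, (ihψ _).2 ?_, hinj.image_injective ?_⟩
      · rwa [Equiv.image_preimage]
      · rw [h, hinr, Equiv.image_preimage]
  | or φ ψ ihφ ihψ =>
    have hfun : (fun t => (or φ ψ).graph.IsIndepSet t) = fun t : Set (φ.Leaf ⊕ ψ.Leaf) =>
        φ.graph.IsIndepSet (Sum.inl ⁻¹' t) ∧ ψ.graph.IsIndepSet (Sum.inr ⁻¹' t) :=
      funext fun t => propext (isIndepSet_or φ ψ t)
    rw [hfun]
    refine (sumSets_iff φ.toAbsProp.res ψ.toAbsProp.res s).trans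
      (Iff.trans ?_ (maximal_preimage_inl_inr _ _ (Sum.map φ.leafEquiv ψ.leafEquiv '' s)).symm)
    have hinl : ∀ s : Set (φ.toAbsProp.Leaf ⊕ ψ.toAbsProp.Leaf),
        Sum.inl ⁻¹' (Sum.map φ.leafEquiv ψ.leafEquiv '' s) = φ.leafEquiv '' (Sum.inl ⁻¹' s) := by
      intro s
      ext x
      simp only [Set.mem_preimage, Set.mem_image, Sum.exists, Sum.map_inl, Sum.map_inr,
        Sum.inl.injEq, reduceCtorEq, and_false, exists_false, or_false]
    have hinr : ∀ s : Set (φ.toAbsProp.Leaf ⊕ ψ.toAbsProp.Leaf),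
        Sum.inr ⁻¹' (Sum.map φ.leafEquiv ψ.leafEquiv '' s) = ψ.leafEquiv '' (Sum.inr ⁻¹' s) := by
      intro s
      ext x
      simp only [Set.mem_preimage, Set.mem_image, Sum.exists, Sum.map_inl, Sum.map_inr,
        Sum.inr.injEq, reduceCtorEq, and_false, exists_false, false_or]
    exact and_congr ((ihφ _).trans (iff_of_eq (congrArg _ (hinl s).symm)))
      ((ihψ _).trans (iff_of_eq (congrArg _ (hinr s).symm)))

theorem toAbsProp_isSyntactic (φ : Formula K) : φ.toAbsProp.IsSyntactic :=
  ⟨φ, φ.leafEquiv, φ.label_leafEquiv, φ.mem_res_iff_maximal⟩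

end Formula

/-! ### The equivalence between formulas and syntactic propositions -/

/-- A bijection of leaves that respects labels and resolutions, as a morphism. It respects
coresolutions because these are the sets orthogonal to all resolutions. -/
def AbsProp.homOfEquiv {A B : AbsProp K} (e : A.Leaf ≃ B.Leaf)
    (hlabel : ∀ x, B.label (e x) = A.label x) (hres : ∀ s, s ∈ A.res ↔ e '' s ∈ B.res) :
    A.toGRel ⟶ B.toGRel where
  rel := {p | e p.1 = p.2}
  label_eq x y h := by
    obtain rfl : e x = y := h
    exact (hlabel x).symm
  preimage_res t ht := by
    have h : SetRel.preimage {p : A.Leaf × B.Leaf | e p.1 = p.2} t = e ⁻¹' t := by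
      ext x
      simp
    refine h ▸ (hres _).2 ?_
    rwa [Equiv.image_preimage]
  image_cores s hs t ht := by
    obtain ⟨x, ⟨hx, hx'⟩, huniq⟩ := hs (e ⁻¹' t) ((hres _).2 (by rwa [Equiv.image_preimage]))
    refine ⟨e x, ⟨⟨x, hx, rfl⟩, hx'⟩, ?_⟩
    rintro _ ⟨⟨y, hy, rfl : e y = _⟩, hy'⟩
    exact congrArg e (huniq y ⟨hy, hy'⟩)

/-- A bijection of leaves that respects labels and resolutions is an isomorphism. -/
def AbsProp.isoOfEquiv {A B : AbsProp K} (e : A.Leaf ≃ B.Leaf)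
    (hlabel : ∀ x, B.label (e x) = A.label x) (hres : ∀ s, s ∈ A.res ↔ e '' s ∈ B.res) :
    A.toGRel ≅ B.toGRel where
  hom := homOfEquiv e hlabel hres
  inv := homOfEquiv e.symm (fun y => by rw [← hlabel, e.apply_symm_apply])
    (fun t => by rw [hres, Equiv.image_symm_eq_preimage, Equiv.image_preimage])
  hom_inv_id := GRel.hom_ext fun x y => by
    constructor
    · rintro ⟨_, rfl : e x = _, h : e.symm (e x) = y⟩
      exact (e.symm_apply_apply x).symm.trans h
    · rintro rfl
      exact ⟨e x, rfl, e.symm_apply_apply x⟩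
  inv_hom_id := GRel.hom_ext fun x y => by
    constructor
    · rintro ⟨_, rfl : e.symm x = _, h : e (e.symm x) = y⟩
      exact (e.apply_symm_apply x).symm.trans h
    · rintro rfl
      exact ⟨e.symm x, rfl, e.apply_symm_apply x⟩

namespace CWStrict

/-- The functor from formulas to syntactic propositions. -/
def toCW (K : Type u) : CWStrict K ⥤ CW K where
  obj φ := ⟨(Formula.toAbsProp φ).toGRel, _, Formula.toAbsProp_isSyntactic φ, rfl⟩
  map f := ObjectProperty.homMk f.hom

instance : (toCW K).Full where
  map_surjective f := ⟨InducedCategory.homMk f.hom, rfl⟩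

instance : (toCW K).Faithful where
  map_injective h := InducedCategory.hom_ext (congrArg (·.hom) h)

instance : (toCW K).EssSurj where
  mem_essImage := by
    rintro ⟨_, A, ⟨φ, e, hlabel, hres⟩, rfl⟩
    refine ⟨φ, ⟨ObjectProperty.isoMk _ (AbsProp.isoOfEquiv (e.trans φ.leafEquiv.symm)
      (fun x => ?_) (fun s => ?_)).symm⟩⟩
    · rw [← Formula.label_leafEquiv, Equiv.trans_apply, Equiv.apply_symm_apply, hlabel]
    · rw [hres, Formula.mem_res_iff_maximal, ← Set.image_comp]
      have : φ.leafEquiv ∘ (e.trans φ.leafEquiv.symm) = e :=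
        funext fun x => φ.leafEquiv.apply_symm_apply (e x)
      rw [this]

instance : (toCW K).IsEquivalence where

instance : HasBinaryProducts (CWStrict K) := by
  have : ∀ {φ ψ : CWStrict K}, HasLimit (pair φ ψ) := fun {φ ψ} =>
    (data_isProductSum.isProduct φ ψ).elim fun h => ⟨⟨_, h⟩⟩
  exact hasBinaryProducts_of_hasLimit_pair _

instance : HasBinaryCoproducts (CWStrict K) := by
  have : ∀ {φ ψ : CWStrict K}, HasColimit (pair φ ψ) := fun {φ ψ} =>
    (data_isProductSum.isSum φ ψ).elim fun h => ⟨⟨_, h⟩⟩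
  exact hasBinaryCoproducts_of_hasColimit_pair _

end CWStrict

/-! ### Freeness of the category of syntactic propositions -/

/-- The chosen products and sums of a category that has binary products and coproducts. -/
noncomputable def ProductSumData.ofHas (C : Type u₁) [Category.{v₁} C] [HasBinaryProducts C]
    [HasBinaryCoproducts C] : ProductSumData C where
  prod X Y := X ⨯ Y
  fst _ _ := prod.fst
  snd _ _ := prod.snd
  sum X Y := X ⨿ Y
  inl _ _ := coprod.inl
  inr _ _ := coprod.inr

theorem ProductSumData.ofHas_isProductSum (C : Type u₁) [Category.{v₁} C] [HasBinaryProducts C]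
    [HasBinaryCoproducts C] : (ofHas C).IsProductSum where
  isProduct X Y := ⟨prodIsProd X Y⟩
  isSum X Y := ⟨coprodIsCoprod X Y⟩

section Restrict

variable {C : Type u₁} [Category.{v₁} C]

theorem CW.preservesFormulas {F : CW K ⥤ C} (hF : productSumFunctor (CW K) C F) :
    PreservesFormulas (CWStrict.toCW K ⋙ F) := by
  obtain ⟨_, _⟩ := hF
  exact preservesFormulas_of_productSumFunctor ⟨inferInstance, inferInstance⟩

instance restrictToGenerators_faithful :
    (restrictToGenerators (CW.gen (K := K)) C).Faithful where
  map_injective {F G α β} h := by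
    refine ObjectProperty.hom_ext _ ?_
    apply ((Functor.whiskeringLeft _ _ C).obj (CWStrict.toCW K)).map_injective
    exact (CW.preservesFormulas F.property).natTrans_ext (CW.preservesFormulas G.property)
      fun k => congrArg (fun γ => γ.app ⟨k⟩) h

instance restrictToGenerators_full :
    (restrictToGenerators (CW.gen (K := K)) C).Full where
  map_surjective {F G} α := by
    obtain ⟨β, hβ⟩ := (CW.preservesFormulas F.property).exists_natTrans
      (CW.preservesFormulas G.property) fun k => α.app ⟨k⟩
    obtain ⟨γ, hγ⟩ :=
      ((Functor.whiskeringLeft _ _ C).obj (CWStrict.toCW K)).map_surjective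
        (X := F.obj) (Y := G.obj) β
    refine ⟨ObjectProperty.homMk γ, ?_⟩
    ext ⟨k⟩
    exact (congrArg (fun δ => δ.app (CWStrict.gen k)) hγ).trans (hβ k)

instance restrictToGenerators_essSurj [HasBinaryProducts C] [HasBinaryCoproducts C] :
    (restrictToGenerators (CW.gen (K := K)) C).EssSurj where
  mem_essImage X := by
    have hT := ProductSumData.ofHas_isProductSum C
    let F : CWStrict K ⥤ C := interpFunctor (ProductSumData.ofHas C) (fun k => X.obj ⟨k⟩) hT
    have hF : productSumFunctor (CWStrict K) C F :=
      ((interpFunctor_strictlyPreserves hT).preservesFormulas hT).productSumFunctor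
    obtain ⟨_, _⟩ := hF
    refine ⟨⟨(CWStrict.toCW K).inv ⋙ F, inferInstance, inferInstance⟩,
      ⟨Discrete.natIso fun ⟨k⟩ => ?_⟩⟩
    -- `CW.gen k` is definitionally the image of the formula `k`
    exact F.mapIso ((CWStrict.toCW K).asEquivalence.unitIso.app (CWStrict.gen k)).symm

end Restrict

end CWLogic

theorem mainTheorem1 (K : Type u) :
    -- `CW_K` is a binary product-sum category, and it is free on `K` in the 2-categorical sense
    (HasBinaryProducts (CW K) ∧ HasBinaryCoproducts (CW K) ∧
      ∀ (C : Type u₁) [Category.{v₁} C] [HasBinaryProducts C] [HasBinaryCoproducts C],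
        (restrictToGenerators (CW.gen (K := K)) C).IsEquivalence) ∧
    -- the strict version is initial among binary product-sum categories with chosen products and
    -- sums and a map from `K` to the objects
    ((CWStrict.data K).IsProductSum ∧
      ∀ (C : Type u₁) [Category.{v₁} C] (T : ProductSumData C), T.IsProductSum →
        ∀ f : K → C, ∃! F : CWStrict K ⥤ C,
          StrictlyPreserves (CWStrict.data K) T F ∧ ∀ k, F.obj (CWStrict.gen k) = f k) := by
  refine ⟨⟨?_, ?_, fun C _ _ _ => { }⟩, CWStrict.data_isProductSum, fun C _ T hT f => ?_⟩
  · exact Adjunction.hasLimitsOfShape_of_equivalence (CWStrict.toCW K).inv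
  · exact Adjunction.hasColimitsOfShape_of_equivalence (CWStrict.toCW K).inv
  · refine ⟨interpFunctor T f hT, ⟨interpFunctor_strictlyPreserves hT, fun _ => rfl⟩, ?_⟩
    rintro G ⟨hG, hGf⟩
    exact hG.functor_eq hT (interpFunctor_strictlyPreserves hT) hGf
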